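/- Let $m,n$ be nonnegative integers. Fix the tuning parameters $(\lambda,\gamma)$ and let $P=P(\cdot\,;\lambda,\gamma):[0,\infty)\to\mathbb{R}$ be a penalty function that is continuous on $[0,\infty)$, differentiable on $(0,\infty)$, and satisfies $P(0)\le \tfrac12\alpha^2+P(\alpha)$ for all $\alpha\ge 0$, i.e. $0$ is a minimizer of $\alpha\mapsto\tfrac12\alpha^2+P(\alpha)$ over $\alpha\ge0$ (this holds in particular if $P$ is nondecreasing). Put $$\phi_P:=\inf_{\alpha,\alpha'>0,\ \alpha\ne\alpha'}\frac{P'(\alpha)-P'(\alpha')}{\alpha-\alpha'}\in[-\infty,\infty)$$ and assume $1+\phi_P>0$. For a real $m\times n$ matrix $X$ let $\sigma_1(X)\ge\dots\ge\sigma_{\min\{m,n\}}(X)\ge 0$ denote its singular values. For a real $m\times n$ matrix $Z$ let $$S_{\lambda,\gamma}(Z)\in\operatorname*{arg\,min}_{X\in\mathbb{R}^{m\times n}}\ \tfrac12\|X-Z\|_F^2+\sum_{i=1}^{\min\{m,n\}}P(\sigma_i(X)),$$ and for $\sigma\ge0$ let $$s_{\lambda,\gamma}(\sigma)\in\operatorname*{arg\,min}_{\alpha\ge0}\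 \tfrac12(\alpha-\sigma)^2+P(\alpha).$$ Then both minimizers exist and are unique. Let $Z=\mu+\varepsilon$, where $\mu$ is a fixed real $m\times n$ matrix and the entries $\varepsilon_{ij}$ of $\varepsilon$ are i.i.d. $N(0,\mathrm{v}^2)$ with $\mathrm{v}>0$, and let $\sigma_i=\sigma_i(Z)$, $i=1,\dots,\min\{m,n\}$. Almost surely, the $\sigma_i$ are positive and pairwise distinct and $s_{\lambda,\gamma}$ is differentiable at each of them. The entries of $S_{\lambda,\gamma}(Z)$ are square integrable, the random variable under the expectation on the right-hand side below is integrable, and the degrees of freedom $$\mathit{df}(S_{\lambda,\gamma}(Z)):=\frac1{\mathrm{v}^2}\sum_{i=1}^{m}\sum_{j=1}^{n}\operatorname{Cov}\big(S_{\lambda,\gamma}(Z)_{ij},Z_{ij}\big)$$ are given by $$\mathit{df}(S_{\lambda,\gamma}(Z))=\mathbb{E}\Bigg(\sum_{i=1}^{\min\{m,n\}}\Big(s_{\lambda,\gamma}'(\sigma_i)+|m-n|\,\frac{s_{\lambda,\gamma}(\sigma_i)}{\sigma_i}\Big)+2\sum_{\substack{1\le i,j\le\min\{m,n\}\\ i\ne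 j}}\frac{\sigma_i\,s_{\lambda,\gamma}(\sigma_i)}{\sigma_i^2-\sigma_j^2}\Bigg),$$ where the last sum is over ordered pairs $(i,j)$. -/

import Mathlib

open MeasureTheory ProbabilityTheory
open scoped NNReal ENNReal

noncomputable section

/-- The `k`-th largest singular value (counted from `k = 0`) of a real `m × n` matrix; the singular
values `σ₁ ≥ σ₂ ≥ …` of the matrix are the values at `k < min m n`. -/
def singVal {m n : ℕ} (A : Matrix (Fin m) (Fin n) ℝ) (k : ℕ) : ℝ :=
  (Matrix.toEuclideanLin A).singularValues k

/-- The amount of concavity of a penalty `P` that is differentiable on `(0, ∞)`: the infimum, in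
the extended reals, of the difference quotients of `P'` over distinct points of `(0, ∞)`. -/
def concavityIndex (P : ℝ → ℝ) : EReal :=
  ⨅ (a : ℝ) (b : ℝ) (_ : 0 < a) (_ : 0 < b) (_ : a ≠ b),
    (((deriv P a - deriv P b) / (a - b) : ℝ) : EReal)

/-- The spectrally penalized least squares criterion
`½ ‖X - Z‖_F² + ∑_{k ≤ min m n} P (σ_k X)`. -/
def spectralObjective {m n : ℕ} (P : ℝ → ℝ) (Z X : Matrix (Fin m) (Fin n) ℝ) : ℝ :=
  1 / 2 * (∑ i, ∑ j, (X i j - Z i j) ^ 2) + ∑ k ∈ Finset.range (min m n), P (singVal X k)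

/-- `X` is a global minimizer of the spectrally penalized least squares criterion at `Z`. -/
def IsSpectralMinimizer {m n : ℕ} (P : ℝ → ℝ) (Z X : Matrix (Fin m) (Fin n) ℝ) : Prop :=
  ∀ Y : Matrix (Fin m) (Fin n) ℝ, spectralObjective P Z X ≤ spectralObjective P Z Y

/-- The spectral thresholding operator `Z ↦ S Z`: a minimizer of `spectralObjective P Z`. -/
def spectralThreshold {m n : ℕ} (P : ℝ → ℝ) (Z : Matrix (Fin m) (Fin n) ℝ) :
    Matrix (Fin m) (Fin n) ℝ :=
  Classical.epsilon (IsSpectralMinimizer P Z)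

/-- `a` minimizes `½ (a - x)² + P a` over `a ≥ 0`. -/
def IsScalarMinimizer (P : ℝ → ℝ) (x a : ℝ) : Prop :=
  0 ≤ a ∧ ∀ b : ℝ, 0 ≤ b → 1 / 2 * (a - x) ^ 2 + P a ≤ 1 / 2 * (b - x) ^ 2 + P b

/-- The univariate thresholding operator `x ↦ s x`: a minimizer of `½ (a - x)² + P a` over
`a ≥ 0`. -/
def scalarThreshold (P : ℝ → ℝ) (x : ℝ) : ℝ :=
  Classical.epsilon (IsScalarMinimizer P x)

/-- The effective degrees of freedom `∑ᵢⱼ Cov (F(Z)ᵢⱼ, Zᵢⱼ) / v²` of the estimator `F(Z)` of the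
mean of the random matrix `Z`, whose entries have variance `v²`. -/
def degreesOfFreedom {Ω : Type*} [MeasurableSpace Ω] (ρ : Measure Ω) {m n : ℕ} (v : ℝ)
    (F : Matrix (Fin m) (Fin n) ℝ → Matrix (Fin m) (Fin n) ℝ)
    (Z : Ω → Matrix (Fin m) (Fin n) ℝ) : ℝ :=
  (∑ i, ∑ j, cov[fun ω => F (Z ω) i j, fun ω => Z ω i j; ρ]) / v ^ 2

/-- The expression
`∑ᵢ (s'(σᵢ) + |m - n| s(σᵢ)/σᵢ) + 2 ∑_{i ≠ j} σᵢ s(σᵢ)/(σᵢ² - σⱼ²)`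
in the singular values `σ₁, …, σ_{min m n}` of an `m × n` matrix `A`; the last sum is over ordered
pairs. -/
def dfExpression {m n : ℕ} (s : ℝ → ℝ) (A : Matrix (Fin m) (Fin n) ℝ) : ℝ :=
  (∑ i ∈ Finset.range (min m n),
      (deriv s (singVal A i) + |(m : ℝ) - (n : ℝ)| * (s (singVal A i) / singVal A i)))
    + 2 * ∑ i ∈ Finset.range (min m n), ∑ j ∈ (Finset.range (min m n)).erase i,
        singVal A i * s (singVal A i) / (singVal A i ^ 2 - singVal A j ^ 2)

end

/-! The hypothesis on the concavity index gives a constant `c > 0` for which `½ (a - x)² + P a` is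
`c`-strongly convex in `a`. The scalar minimizer `s` is therefore unique, and both `s` and `x ↦ x -
c s x` are nondecreasing. If `Z = U Σ Vᵀ` and `X = U s(Σ) Vᵀ`, then `Z - c X` has the same singular
vectors and ordered, nonnegative singular values. Von Neumann's trace inequality for `Z - c X` lifts
the scalar quadratic growth to matrices (`spectralObjective_quadratic_growth`). Hence `X` is the
unique spectral minimizer, and `S` is Lipschitz in the Frobenius norm with constant `1 / c`.

Since `S` is Lipschitz, Stein's identity (`integral_mul_sub_pi_gaussianReal`) turns the degrees of
freedom into the expected divergence of `S`, and Rademacher's theorem makes `S` differentiable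
almost everywhere. Off a null set the singular values are positive and distinct
(`ae_singVal_pos_and_ne`), because a polynomial in the entries that is not identically zero vanishes
wherever this fails.

No perturbation theory of singular vectors enters the divergence. At a point where the derivative is
known to exist, equivariance of `S` under orthogonal conjugation reduces to a rectangular diagonal
matrix. There, moving one diagonal entry produces `s'`, and differentiating equivariance along plane
rotations produces the off-diagonal entries. Differentiability of `s` at the singular values comes
out as a consequence of that of `S`. -/

/-! ### Strong convexity and the scalar thresholding operator. -/

section ScalarThreshold

/-- A positive lower bound for `1 + concavityIndex P`, in terms of difference quotients. -/
lemma exists_pos_le_of_concavityIndex {P : ℝ → ℝ} (h : 0 < 1 + concavityIndex P) :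
    ∃ c : ℝ, 0 < c ∧ ∀ a b : ℝ, 0 < a → 0 < b → a ≠ b →
      c - 1 ≤ (deriv P a - deriv P b) / (a - b) := by
  have h1 : ((-1 : ℝ) : EReal) < concavityIndex P := by
    by_contra hcon
    have hle : concavityIndex P ≤ ((-1 : ℝ) : EReal) := not_lt.mp hcon
    have h2 : (1 : EReal) + concavityIndex P ≤ 1 + ((-1 : ℝ) : EReal) := by gcongr
    have h3 : (1 : EReal) + ((-1 : ℝ) : EReal) = 0 := by
      rw [← EReal.coe_one, ← EReal.coe_add]; simp
    exact absurd h (not_lt.mpr (h3 ▸ h2))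
  -- The index is an extended real, so a real `q` is placed between `-1` and it; then `c = 1 + q`.
  obtain ⟨q, hq1, hq2⟩ := EReal.lt_iff_exists_real_btwn.mp h1
  have hq1' : (-1 : ℝ) < q := by exact_mod_cast hq1
  refine ⟨1 + q, by linarith, fun a b ha hb hab => ?_⟩
  have h4 : concavityIndex P ≤ (((deriv P a - deriv P b) / (a - b) : ℝ) : EReal) :=
    iInf_le_of_le a <| iInf_le_of_le b <| iInf_le_of_le ha <| iInf_le_of_le hb <|
      iInf_le_of_le hab le_rfl
  have h5 := EReal.coe_lt_coe_iff.mp (hq2.trans_le h4)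
  linarith

/-- The slope bound makes `P' a + (1 - c) a` nondecreasing on `(0, ∞)`, and continuity carries
convexity to the endpoint `0`. Adding `½ (a - x)²` gives a `c`-strongly convex criterion, the form
in which the hypothesis on the index is used from here on. -/
lemma convexOn_penalty {P : ℝ → ℝ} (hP_cont : ContinuousOn P (Set.Ici 0))
    (hP_diff : ∀ a : ℝ, 0 < a → DifferentiableAt ℝ P a) {c : ℝ}
    (hc : ∀ a b : ℝ, 0 < a → 0 < b → a ≠ b → c - 1 ≤ (deriv P a - deriv P b) / (a - b)) :
    ConvexOn ℝ (Set.Ici 0) (fun a => P a + (1 - c) / 2 * a ^ 2) := by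
  have hd : ∀ a : ℝ, 0 < a →
      HasDerivAt (fun a => P a + (1 - c) / 2 * a ^ 2) (deriv P a + (1 - c) * a) a := by
    intro a ha
    exact ((hP_diff a ha).hasDerivAt.add
      ((hasDerivAt_pow 2 a).const_mul ((1 - c) / 2))).congr_deriv (by push_cast; ring)
  refine MonotoneOn.convexOn_of_deriv (convex_Ici 0) (hP_cont.add (by fun_prop)) ?_ ?_
  · intro a ha
    rw [interior_Ici] at ha
    exact (hd a ha).differentiableAt.differentiableWithinAt
  · intro a ha b hb hab
    rw [interior_Ici] at ha hb
    rw [(hd a ha).deriv, (hd b hb).deriv]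
    rcases hab.eq_or_lt with rfl | hlt
    · exact le_rfl
    · have := hc b a hb ha hlt.ne'
      rw [le_div_iff₀ (sub_pos.mpr hlt)] at this
      linarith

/-- Quadratic growth of a strongly convex criterion around a minimizer. -/
lemma IsScalarMinimizer.quadratic_growth {P : ℝ → ℝ} {c : ℝ}
    (hconv : ConvexOn ℝ (Set.Ici 0) (fun a => P a + (1 - c) / 2 * a ^ 2)) {x a b : ℝ}
    (ha : IsScalarMinimizer P x a) (hb : 0 ≤ b) :
    1 / 2 * (a - x) ^ 2 + P a + c / 2 * (b - a) ^ 2 ≤ 1 / 2 * (b - x) ^ 2 + P b := by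
  -- Compare the minimizer with the point `(1 - t) a + t b`, divide by `t`, and let `t` tend to `0`.
  have key : ∀ t : ℝ, 0 < t → t ≤ 1 →
      1 / 2 * (a - x) ^ 2 + P a + c / 2 * (1 - t) * (b - a) ^ 2
        ≤ 1 / 2 * (b - x) ^ 2 + P b := by
    intro t ht ht1
    have h1 := hconv.2 (Set.mem_Ici.mpr ha.1) (Set.mem_Ici.mpr hb) (sub_nonneg.mpr ht1) ht.le
      (by ring)
    have h2 := ha.2 ((1 - t) * a + t * b)
      (add_nonneg (mul_nonneg (sub_nonneg.mpr ht1) ha.1) (mul_nonneg ht.le hb))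
    simp only [smul_eq_mul] at h1
    have h3 : t * (1 / 2 * (a - x) ^ 2 + P a + c / 2 * (1 - t) * (b - a) ^ 2)
        ≤ t * (1 / 2 * (b - x) ^ 2 + P b) := by nlinarith
    exact le_of_mul_le_mul_left h3 ht
  have hlim : Filter.Tendsto
      (fun t : ℝ => 1 / 2 * (a - x) ^ 2 + P a + c / 2 * (1 - t) * (b - a) ^ 2)
      (nhdsWithin 0 (Set.Ioi 0)) (nhds (1 / 2 * (a - x) ^ 2 + P a + c / 2 * (b - a) ^ 2)) := by
    have : Continuous
      (fun t : ℝ => 1 / 2 * (a - x) ^ 2 + P a + c / 2 * (1 - t) * (b - a) ^ 2) := by fun_prop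
    have h := (this.tendsto 0).mono_left (nhdsWithin_le_nhds (s := Set.Ioi 0))
    simpa using h
  refine le_of_tendsto hlim ?_
  filter_upwards [Ioc_mem_nhdsGT (zero_lt_one' ℝ)] with t ht using key t ht.1 ht.2

/-- Scalar minimizers depend on the data in a `c`-cocoercive way. -/
lemma IsScalarMinimizer.cocoercive {P : ℝ → ℝ} {c : ℝ}
    (hconv : ConvexOn ℝ (Set.Ici 0) (fun a => P a + (1 - c) / 2 * a ^ 2)) {x y a b : ℝ}
    (ha : IsScalarMinimizer P x a) (hb : IsScalarMinimizer P y b) :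
    c * (a - b) ^ 2 ≤ (x - y) * (a - b) := by
  have h1 := ha.quadratic_growth hconv hb.1
  have h2 := hb.quadratic_growth hconv ha.1
  nlinarith

lemma exists_isScalarMinimizer {P : ℝ → ℝ} {c : ℝ} (hc : 0 < c)
    (hP_cont : ContinuousOn P (Set.Ici 0))
    (hconv : ConvexOn ℝ (Set.Ici 0) (fun a => P a + (1 - c) / 2 * a ^ 2))
    (hP_zero : ∀ a : ℝ, 0 ≤ a → P 0 ≤ 1 / 2 * a ^ 2 + P a) (x : ℝ) :
    ∃ a, IsScalarMinimizer P x a := by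
  have h0 : IsScalarMinimizer P 0 0 := ⟨le_rfl, fun b hb => by simpa using hP_zero b hb⟩
  -- Quadratic growth at data `0`, whose minimizer is `0`, bounds the criterion at `b` below by its
  -- value at `0` plus `c / 2 * b² - x b`. This excess is nonnegative beyond `R`, so minimizing over
  -- the compact interval `[0, R]` is enough.
  set R := 2 * |x| / c with hR
  have hR0 : 0 ≤ R := by positivity
  obtain ⟨a, haR, hamin⟩ := (isCompact_Icc (a := (0 : ℝ)) (b := R)).exists_isMinOn
    ⟨0, le_rfl, hR0⟩ (f := fun a => 1 / 2 * (a - x) ^ 2 + P a)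
    (ContinuousOn.add (by fun_prop) (hP_cont.mono fun _ h => h.1))
  refine ⟨a, haR.1, fun b hb => ?_⟩
  by_cases hbR : b ≤ R
  · exact hamin ⟨hb, hbR⟩
  · have h1 : 1 / 2 * (a - x) ^ 2 + P a ≤ 1 / 2 * (0 - x) ^ 2 + P 0 := hamin ⟨le_rfl, hR0⟩
    have h2 := h0.quadratic_growth hconv hb
    have h3 : 2 * |x| < b * c := (div_lt_iff₀ hc).mp (not_le.mp hbR)
    have h4 : x * b ≤ |x| * b := mul_le_mul_of_nonneg_right (le_abs_self x) hb
    have h5 : 2 * |x| * b ≤ b * c * b := mul_le_mul_of_nonneg_right h3.le hb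
    nlinarith

variable {P : ℝ → ℝ} {c : ℝ}

lemma isScalarMinimizer_scalarThreshold (hc : 0 < c) (hP_cont : ContinuousOn P (Set.Ici 0))
    (hconv : ConvexOn ℝ (Set.Ici 0) (fun a => P a + (1 - c) / 2 * a ^ 2))
    (hP_zero : ∀ a : ℝ, 0 ≤ a → P 0 ≤ 1 / 2 * a ^ 2 + P a) (x : ℝ) :
    IsScalarMinimizer P x (scalarThreshold P x) :=
  Classical.epsilon_spec (exists_isScalarMinimizer hc hP_cont hconv hP_zero x)

lemma IsScalarMinimizer.eq (hc : 0 < c)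
    (hconv : ConvexOn ℝ (Set.Ici 0) (fun a => P a + (1 - c) / 2 * a ^ 2)) {x a b : ℝ}
    (ha : IsScalarMinimizer P x a) (hb : IsScalarMinimizer P x b) : a = b := by
  have h := ha.cocoercive hconv hb
  simp only [sub_self, zero_mul] at h
  have h1 : (a - b) ^ 2 = 0 := le_antisymm (nonpos_of_mul_nonpos_right h hc) (sq_nonneg _)
  exact sub_eq_zero.mp (pow_eq_zero_iff two_ne_zero |>.mp h1)

lemma isScalarMinimizer_iff (hc : 0 < c) (hP_cont : ContinuousOn P (Set.Ici 0))
    (hconv : ConvexOn ℝ (Set.Ici 0) (fun a => P a + (1 - c) / 2 * a ^ 2))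
    (hP_zero : ∀ a : ℝ, 0 ≤ a → P 0 ≤ 1 / 2 * a ^ 2 + P a) (x a : ℝ) :
    IsScalarMinimizer P x a ↔ a = scalarThreshold P x := by
  have h := isScalarMinimizer_scalarThreshold hc hP_cont hconv hP_zero x
  exact ⟨fun ha => ha.eq hc hconv h, fun ha => ha ▸ h⟩

lemma scalarThreshold_zero (hc : 0 < c) (hP_cont : ContinuousOn P (Set.Ici 0))
    (hconv : ConvexOn ℝ (Set.Ici 0) (fun a => P a + (1 - c) / 2 * a ^ 2))
    (hP_zero : ∀ a : ℝ, 0 ≤ a → P 0 ≤ 1 / 2 * a ^ 2 + P a) : scalarThreshold P 0 = 0 :=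
  ((isScalarMinimizer_iff hc hP_cont hconv hP_zero 0 0).mp
    ⟨le_rfl, fun b hb => by simpa using hP_zero b hb⟩).symm

/-- The scalar thresholding operator and its complement `x ↦ x - c s x` are nondecreasing. -/
lemma scalarThreshold_mono (hc : 0 < c) (hP_cont : ContinuousOn P (Set.Ici 0))
    (hconv : ConvexOn ℝ (Set.Ici 0) (fun a => P a + (1 - c) / 2 * a ^ 2))
    (hP_zero : ∀ a : ℝ, 0 ≤ a → P 0 ≤ 1 / 2 * a ^ 2 + P a) {x y : ℝ} (hxy : x ≤ y) :
    scalarThreshold P x ≤ scalarThreshold P y ∧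
      x - c * scalarThreshold P x ≤ y - c * scalarThreshold P y := by
  have h := (isScalarMinimizer_scalarThreshold hc hP_cont hconv hP_zero y).cocoercive hconv
    (isScalarMinimizer_scalarThreshold hc hP_cont hconv hP_zero x)
  set a := scalarThreshold P x
  set b := scalarThreshold P y
  have hab : a ≤ b := by
    by_contra hlt
    have hlt' : b < a := not_le.mp hlt
    have h1 : (y - x) * (b - a) ≤ 0 :=
      mul_nonpos_of_nonneg_of_nonpos (by linarith) (by linarith)
    have h2 : 0 < c * (b - a) ^ 2 := mul_pos hc (by nlinarith)
    linarith
  refine ⟨hab, ?_⟩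
  rcases hab.eq_or_lt with heq | hlt
  · rw [heq]; linarith
  · have h1 : (c * (b - a)) * (b - a) ≤ (y - x) * (b - a) := by nlinarith
    have := le_of_mul_le_mul_right h1 (sub_pos.mpr hlt)
    linarith

end ScalarThreshold

/-! ### Von Neumann's trace inequality and uniqueness of singular values. -/

section TraceInequality

/-- A substochastic bilinear form in two nonincreasing nonnegative sequences is at most their
diagonal pairing. -/
lemma sum_mul_le_of_substochastic {r : ℕ} {x y : ℕ → ℝ} (hx : Antitone x) (hy : Antitone y)
    (hx0 : ∀ k, 0 ≤ x k) (hy0 : ∀ k, 0 ≤ y k) {Q : Fin r → Fin r → ℝ}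
    (hQ : ∀ k l, 0 ≤ Q k l) (hrow : ∀ k, ∑ l, Q k l ≤ 1) (hcol : ∀ l, ∑ k, Q k l ≤ 1) :
    ∑ k : Fin r, ∑ l : Fin r, x k * y l * Q k l ≤ ∑ k : Fin r, x k * y k := by
  -- A dual certificate for an assignment problem: `p`, a tail sum for `k ≤ r`, and `q` are
  -- nonnegative potentials with `x k * y l ≤ p k + q l` and equality on the diagonal.
  set p : ℕ → ℝ := fun k => ∑ i ∈ Finset.range r, y i * (x i - x (i + 1))
    - ∑ i ∈ Finset.range k, y i * (x i - x (i + 1)) with hp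
  set q : ℕ → ℝ := fun k => x k * y k - p k with hq
  have hstep : ∀ k, p k - p (k + 1) = y k * (x k - x (k + 1)) := by
    intro k
    simp only [hp, Finset.sum_range_succ]
    ring
  have hdec : ∀ k, 0 ≤ x k - x (k + 1) := fun k => sub_nonneg.mpr (hx k.le_succ)
  have hdecy : ∀ k, 0 ≤ y k - y (k + 1) := fun k => sub_nonneg.mpr (hy k.le_succ)
  have hpa : Antitone p := antitone_nat_of_succ_le fun k => by
    have := mul_nonneg (hy0 k) (hdec k)
    linarith [hstep k]
  have hqa : Antitone q := antitone_nat_of_succ_le fun k => by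
    have h1 := mul_nonneg (hx0 (k + 1)) (hdecy k)
    have h2 := hstep k
    simp only [hq]
    nlinarith
  have hp0 : ∀ k ≤ r, 0 ≤ p k := fun k hk => by
    have : p r = 0 := by simp [hp]
    exact this ▸ hpa hk
  have hq0 : ∀ k ≤ r, 0 ≤ q k := fun k hk => by
    have h1 : p r = 0 := by simp [hp]
    have h2 : 0 ≤ q r := by
      simp only [hq, h1, sub_zero]
      exact mul_nonneg (hx0 r) (hy0 r)
    exact h2.trans (hqa hk)
  -- `p k - p l` is a Riemann-type sum of `y` against the decrements of `x`, so it lies between the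
  -- bounds given by the extreme values of `y`.
  have hbd : ∀ k l, k ≤ l → y l * (x k - x l) ≤ p k - p l ∧ p k - p l ≤ y k * (x k - x l) := by
    intro k l hkl
    induction l, hkl using Nat.le_induction with
    | base => simp
    | succ l hkl ih =>
      have h1 := hstep l
      have h2 := hdec l
      have h3 := hy hkl
      have h4 := hdecy l
      have h5 : 0 ≤ x k - x l := sub_nonneg.mpr (hx hkl)
      have h6 : 0 ≤ (y l - y (l + 1)) * (x k - x l) := mul_nonneg h4 h5
      have h7 : 0 ≤ (y l - y (l + 1)) * (x l - x (l + 1)) := mul_nonneg h4 h2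
      have h8 : 0 ≤ (y k - y l) * (x l - x (l + 1)) := mul_nonneg (sub_nonneg.mpr h3) h2
      constructor <;> nlinarith [ih.1, ih.2]
  have hpq : ∀ k l, x k * y l ≤ p k + q l := by
    intro k l
    simp only [hq]
    rcases le_total k l with h | h
    · linarith [(hbd k l h).1]
    · linarith [(hbd l k h).2]
  calc ∑ k : Fin r, ∑ l : Fin r, x k * y l * Q k l
      ≤ ∑ k : Fin r, ∑ l : Fin r, (p k + q l) * Q k l :=
        Finset.sum_le_sum fun k _ => Finset.sum_le_sum fun l _ =>
          mul_le_mul_of_nonneg_right (hpq k l) (hQ k l)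
    _ = ∑ k : Fin r, p k * ∑ l, Q k l + ∑ l : Fin r, q l * ∑ k, Q k l := by
        simp only [add_mul, Finset.sum_add_distrib, Finset.mul_sum]
        congr 1
        exact Finset.sum_comm
    _ ≤ ∑ k : Fin r, p k + ∑ l : Fin r, q l :=
        add_le_add
          (Finset.sum_le_sum fun k _ => mul_le_of_le_one_right (hp0 k k.2.le) (hrow k))
          (Finset.sum_le_sum fun k _ => mul_le_of_le_one_right (hq0 k k.2.le) (hcol k))
    _ = ∑ k : Fin r, x k * y k := by
        rw [← Finset.sum_add_distrib]
        exact Finset.sum_congr rfl fun k _ => by simp [hq]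

/-- The rectangular diagonal matrix with diagonal entries `d 0, d 1, …`. -/
def rectDiag (m n : ℕ) (d : ℕ → ℝ) : Matrix (Fin m) (Fin n) ℝ :=
  Matrix.of fun i j => if (i : ℕ) = j then d i else 0

open Matrix

variable {m n : ℕ}

lemma rectDiag_apply (d : ℕ → ℝ) (i : Fin m) (j : Fin n) :
    rectDiag m n d i j = if (i : ℕ) = j then d i else 0 := rfl

lemma rectDiag_transpose (d : ℕ → ℝ) : (rectDiag m n d)ᵀ = rectDiag n m d := by
  ext i j
  simp only [transpose_apply, rectDiag_apply, eq_comm (a := (j : ℕ))]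
  split_ifs with h
  · rw [h]
  · rfl

lemma sum_rectDiag_mul (d : ℕ → ℝ) (f : Fin m → Fin n → ℝ) :
    ∑ i, ∑ j, rectDiag m n d i j * f i j
      = ∑ k : Fin (min m n), d k * f (k.castLE (min_le_left m n)) (k.castLE (min_le_right m n)) := by
  rw [← Fintype.sum_prod_type']
  symm
  refine Finset.sum_of_injOn
    (fun k => (k.castLE (min_le_left m n), k.castLE (min_le_right m n))) ?_ (by simp) ?_ ?_
  · intro k _ l _ h
    have := congrArg (fun p => (p.1 : ℕ)) h
    exact Fin.ext (by simpa using this)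
  · rintro ⟨i, j⟩ _ hij
    rw [rectDiag_apply, if_neg, zero_mul]
    intro h
    exact hij ⟨⟨i, lt_min i.2 (h ▸ j.2)⟩, by simp, Prod.ext rfl (Fin.ext h)⟩
  · intro k _
    simp [rectDiag_apply]

lemma trace_transpose_mul_eq_sum (A B : Matrix (Fin m) (Fin n) ℝ) :
    (Aᵀ * B).trace = ∑ i, ∑ j, A i j * B i j := by
  simp only [trace, diag_apply, mul_apply, transpose_apply]
  exact Finset.sum_comm

lemma sum_sq_castLE_le {r : ℕ} (h : r ≤ m) {B : Matrix (Fin m) (Fin m) ℝ} (hB : B * Bᵀ = 1)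
    (k : Fin m) : ∑ l : Fin r, B k (l.castLE h) ^ 2 ≤ 1 := by
  have h1 : ∑ l, B k l ^ 2 = 1 := by
    have := congrFun (congrFun hB k) k
    simpa [mul_apply, ← sq] using this
  rw [← h1]
  have h2 := Finset.sum_image (f := fun l => B k l ^ 2) (s := (Finset.univ : Finset (Fin r)))
    (g := Fin.castLE h) (fun _ _ _ _ hab => Fin.castLE_injective h hab)
  rw [← h2]
  exact Finset.sum_le_sum_of_subset_of_nonneg (Finset.subset_univ _) fun _ _ _ => sq_nonneg _

/-- **Von Neumann's trace inequality.** -/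
theorem trace_transpose_mul_le {U U' : Matrix (Fin m) (Fin m) ℝ} {V V' : Matrix (Fin n) (Fin n) ℝ}
    (hU : Uᵀ * U = 1) (hU' : U'ᵀ * U' = 1) (hV : Vᵀ * V = 1) (hV' : V'ᵀ * V' = 1)
    {x y : ℕ → ℝ} (hx : Antitone x) (hy : Antitone y) (hx0 : ∀ k, 0 ≤ x k) (hy0 : ∀ k, 0 ≤ y k) :
    ((U * rectDiag m n x * Vᵀ)ᵀ * (U' * rectDiag m n y * V'ᵀ)).trace
      ≤ ∑ k ∈ Finset.range (min m n), x k * y k := by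
  set B := Uᵀ * U' with hB
  set C := Vᵀ * V' with hC
  have hUU : U * Uᵀ = 1 := mul_eq_one_comm.mp hU
  have hVV : V * Vᵀ = 1 := mul_eq_one_comm.mp hV
  have hUU' : U' * U'ᵀ = 1 := mul_eq_one_comm.mp hU'
  have hVV' : V' * V'ᵀ = 1 := mul_eq_one_comm.mp hV'
  have hBB : B * Bᵀ = 1 := by
    rw [hB, transpose_mul, transpose_transpose, Matrix.mul_assoc, ← Matrix.mul_assoc U', hUU',
      Matrix.one_mul, hU]
  have hCC : C * Cᵀ = 1 := by
    rw [hC, transpose_mul, transpose_transpose, Matrix.mul_assoc, ← Matrix.mul_assoc V', hVV',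
      Matrix.one_mul, hV]
  have hBB' : Bᵀ * Bᵀᵀ = 1 := by rw [transpose_transpose]; exact mul_eq_one_comm.mp hBB
  have hCC' : Cᵀ * Cᵀᵀ = 1 := by rw [transpose_transpose]; exact mul_eq_one_comm.mp hCC
  have h1 : ((U * rectDiag m n x * Vᵀ)ᵀ * (U' * rectDiag m n y * V'ᵀ)).trace
      = ((rectDiag m n x)ᵀ * (B * rectDiag m n y * Cᵀ)).trace := by
    rw [transpose_mul, transpose_transpose, transpose_mul, Matrix.mul_assoc, trace_mul_comm, hB, hC,
      transpose_mul, transpose_transpose]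
    simp only [Matrix.mul_assoc]
  have h2 : ∀ i j, (B * rectDiag m n y * Cᵀ) i j = ∑ k : Fin (min m n),
      y k * (B i (k.castLE (min_le_left m n)) * C j (k.castLE (min_le_right m n))) := by
    intro i j
    rw [← sum_rectDiag_mul y (fun k l => B i k * C j l)]
    simp only [mul_apply, transpose_apply, Finset.sum_mul]
    rw [Finset.sum_comm]
    exact Finset.sum_congr rfl fun k _ => Finset.sum_congr rfl fun l _ => by ring
  rw [h1, trace_transpose_mul_eq_sum,
    sum_rectDiag_mul x (fun i j => (B * rectDiag m n y * Cᵀ) i j), Finset.sum_range]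
  simp only [h2, Finset.mul_sum]
  -- The product of entries of `B` and `C` is at most the mean of their squares. Truncated rows and
  -- columns of orthogonal matrices have norm at most one, so `Q` is substochastic.
  set Q : Fin (min m n) → Fin (min m n) → ℝ := fun k l =>
    (B (k.castLE (min_le_left m n)) (l.castLE (min_le_left m n)) ^ 2
      + C (k.castLE (min_le_right m n)) (l.castLE (min_le_right m n)) ^ 2) / 2 with hQ
  refine le_trans (Finset.sum_le_sum fun k _ => Finset.sum_le_sum fun l _ => ?_)
    (sum_mul_le_of_substochastic hx hy hx0 hy0 (Q := Q) (fun k l => by positivity) ?_ ?_)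
  · rw [← mul_assoc]
    refine mul_le_mul_of_nonneg_left ?_ (mul_nonneg (hx0 _) (hy0 _))
    simp only [hQ]
    nlinarith [two_mul_le_add_sq (B (k.castLE (min_le_left m n)) (l.castLE (min_le_left m n)))
      (C (k.castLE (min_le_right m n)) (l.castLE (min_le_right m n)))]
  · intro k
    simp only [hQ]
    rw [← Finset.sum_div, Finset.sum_add_distrib]
    linarith [sum_sq_castLE_le (min_le_left m n) hBB (k.castLE (min_le_left m n)),
      sum_sq_castLE_le (min_le_right m n) hCC (k.castLE (min_le_right m n))]
  · intro l
    simp only [hQ]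
    rw [← Finset.sum_div, Finset.sum_add_distrib]
    have e1 := sum_sq_castLE_le (min_le_left m n) hBB' (l.castLE (min_le_left m n))
    have e2 := sum_sq_castLE_le (min_le_right m n) hCC' (l.castLE (min_le_right m n))
    simp only [transpose_apply] at e1 e2
    linarith

lemma trace_transpose_mul_same_bases {U : Matrix (Fin m) (Fin m) ℝ} {V : Matrix (Fin n) (Fin n) ℝ}
    (hU : Uᵀ * U = 1) (hV : Vᵀ * V = 1) (x y : ℕ → ℝ) :
    ((U * rectDiag m n x * Vᵀ)ᵀ * (U * rectDiag m n y * Vᵀ)).trace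
      = ∑ k ∈ Finset.range (min m n), x k * y k := by
  have h1 : ((U * rectDiag m n x * Vᵀ)ᵀ * (U * rectDiag m n y * Vᵀ)).trace
      = ((rectDiag m n x)ᵀ * rectDiag m n y).trace := by
    rw [transpose_mul, transpose_transpose, transpose_mul, Matrix.mul_assoc, trace_mul_comm]
    have : (rectDiag m n x)ᵀ * Uᵀ * (U * rectDiag m n y * Vᵀ) * V
        = (rectDiag m n x)ᵀ * (Uᵀ * U) * rectDiag m n y * (Vᵀ * V) := by
      simp only [Matrix.mul_assoc]
    rw [this, hU, hV, Matrix.mul_one, Matrix.mul_one]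
  rw [h1, trace_transpose_mul_eq_sum, sum_rectDiag_mul x (fun i j => rectDiag m n y i j),
    Finset.sum_range]
  simp [rectDiag_apply]

/-- Two ordered singular value decompositions of one matrix have the same singular values. -/
lemma rectDiag_svd_unique {U U' : Matrix (Fin m) (Fin m) ℝ} {V V' : Matrix (Fin n) (Fin n) ℝ}
    (hU : Uᵀ * U = 1) (hU' : U'ᵀ * U' = 1) (hV : Vᵀ * V = 1) (hV' : V'ᵀ * V' = 1)
    {x y : ℕ → ℝ} (hx : Antitone x) (hy : Antitone y) (hx0 : ∀ k, 0 ≤ x k) (hy0 : ∀ k, 0 ≤ y k)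
    (h : U * rectDiag m n x * Vᵀ = U' * rectDiag m n y * V'ᵀ) {k : ℕ} (hk : k < min m n) :
    x k = y k := by
  have key : ∀ l ≤ min m n, ∑ i ∈ Finset.range l, x i = ∑ i ∈ Finset.range l, y i := by
    intro l hl
    -- Pairing with the partial isometry whose singular values are `e` yields the sum of the first
    -- `l` singular values. The trace inequality, applied with the bases of either decomposition,
    -- makes these partial sums agree.
    set e : ℕ → ℝ := fun i => if i < l then 1 else 0 with he
    have hea : Antitone e := by
      intro i j hij
      simp only [he]
      split_ifs with h1 h2
      · exact le_rfl
      · omega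
      · exact zero_le_one
      · exact le_rfl
    have he0 : ∀ i, 0 ≤ e i := fun i => by
      simp only [he]
      split_ifs <;> norm_num
    have hsum : ∀ z : ℕ → ℝ, ∑ i ∈ Finset.range (min m n), z i * e i
        = ∑ i ∈ Finset.range l, z i := by
      intro z
      simp only [he, mul_ite, mul_one, mul_zero]
      rw [← Finset.sum_filter]
      congr 1
      ext i
      simp only [Finset.mem_filter, Finset.mem_range]
      omega
    apply le_antisymm
    · rw [← hsum, ← hsum, ← trace_transpose_mul_same_bases hU hV, h]
      exact trace_transpose_mul_le hU' hU hV' hV hy hea hy0 he0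
    · rw [← hsum, ← hsum, ← trace_transpose_mul_same_bases hU' hV', ← h]
      exact trace_transpose_mul_le hU hU' hV hV' hx hea hx0 he0
  have h1 := key (k + 1) hk
  have h2 := key k hk.le
  rw [Finset.sum_range_succ, Finset.sum_range_succ, h2] at h1
  linarith

end TraceInequality

/-! ### Existence of the singular value decomposition. -/

section SingularValueDecomposition

open Matrix

variable {m n : ℕ}

lemma singVal_nonneg (A : Matrix (Fin m) (Fin n) ℝ) (k : ℕ) : 0 ≤ singVal A k :=
  LinearMap.singularValues_nonneg _ k

lemma singVal_antitone (A : Matrix (Fin m) (Fin n) ℝ) : Antitone (singVal A) :=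
  LinearMap.singularValues_antitone _

lemma singVal_eq_zero_of_le (A : Matrix (Fin m) (Fin n) ℝ) {k : ℕ} (hk : min m n ≤ k) :
    singVal A k = 0 := by
  refine LinearMap.singularValues_eq_zero_iff_le_finrank_range _ |>.mpr (le_trans (le_min ?_ ?_) hk)
  · simpa using Submodule.finrank_le (Matrix.toEuclideanLin A).range
  · simpa using LinearMap.finrank_range_le (Matrix.toEuclideanLin A)

lemma transpose_mul_self_of_orthonormalBasis
    (b : OrthonormalBasis (Fin n) ℝ (EuclideanSpace ℝ (Fin n))) :
    (Matrix.of fun i j => b j i)ᵀ * (Matrix.of fun i j => b j i) = 1 := by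
  ext i j
  have h := orthonormal_iff_ite.mp b.orthonormal i j
  rw [PiLp.inner_apply] at h
  simp only [mul_apply, transpose_apply, of_apply, one_apply]
  rw [← h]
  exact Finset.sum_congr rfl fun k _ => by simp [mul_comm]

/-- **Singular value decomposition.** -/
theorem exists_svd (A : Matrix (Fin m) (Fin n) ℝ) :
    ∃ (U : Matrix (Fin m) (Fin m) ℝ) (V : Matrix (Fin n) (Fin n) ℝ), Uᵀ * U = 1 ∧ Vᵀ * V = 1 ∧
      A = U * rectDiag m n (singVal A) * Vᵀ := by
  set T := Matrix.toEuclideanLin A with hT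
  have hn : Module.finrank ℝ (EuclideanSpace ℝ (Fin n)) = n := finrank_euclideanSpace_fin
  set b := T.isSymmetric_adjoint_comp_self.eigenvectorBasis hn with hb
  set σ : ℕ → ℝ := singVal A with hσ
  have hσsq : ∀ j : Fin n, T.isSymmetric_adjoint_comp_self.eigenvalues hn j = σ j ^ 2 :=
    fun j => (T.sq_singularValues_fin hn j).symm
  have hinner : ∀ i j : Fin n, inner ℝ (T (b i)) (T (b j)) = if i = j then σ j ^ 2 else 0 := by
    intro i j
    rw [← LinearMap.adjoint_inner_right]
    have h1 : (LinearMap.adjoint T) (T (b j)) = (σ j ^ 2 : ℝ) • b j := by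
      rw [← hσsq]
      exact T.isSymmetric_adjoint_comp_self.apply_eigenvectorBasis hn j
    rw [h1, inner_smul_right, orthonormal_iff_ite.mp b.orthonormal i j]
    simp
  have hzero : ∀ j : Fin n, σ j = 0 → T (b j) = 0 := by
    intro j hj
    rw [← inner_self_eq_zero (𝕜 := ℝ), hinner, if_pos rfl, hj]
    simp
  -- The left singular vectors are the normalized images of the eigenvectors of `T* T`, available
  -- only where `σ` is positive; an orthonormal extension supplies the others. Zero columns put no
  -- condition on them.
  set s : Set (Fin m) := {i | 0 < σ i} with hs
  have hsn : ∀ i ∈ s, (i : ℕ) < n := by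
    intro i hi
    by_contra hcon
    have h0 : σ i = 0 := singVal_eq_zero_of_le A ((min_le_right m n).trans (not_lt.mp hcon))
    exact absurd hi (by simp [hs, h0])
  set w : Fin m → EuclideanSpace ℝ (Fin m) := fun i =>
    if h : (i : ℕ) < n then (σ i)⁻¹ • T (b ⟨i, h⟩) else 0 with hw
  have hwon : Orthonormal ℝ (s.domRestrict w) := by
    rw [orthonormal_iff_ite]
    rintro ⟨i, hi⟩ ⟨j, hj⟩
    simp only [Set.domRestrict_apply, hw, dif_pos (hsn i hi), dif_pos (hsn j hj), inner_smul_left,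
      inner_smul_right, hinner, Subtype.mk.injEq, Fin.ext_iff]
    have hj' : σ j ≠ 0 := ne_of_gt hj
    split_ifs with hij
    · rw [hij]
      simp only [conj_trivial]
      field_simp
    · simp
  obtain ⟨u, hu⟩ := hwon.exists_orthonormalBasis_extension_of_card_eq (by simp)
  refine ⟨Matrix.of fun i j => u j i, Matrix.of fun i j => b j i,
    transpose_mul_self_of_orthonormalBasis u, transpose_mul_self_of_orthonormalBasis b, ?_⟩
  set U : Matrix (Fin m) (Fin m) ℝ := Matrix.of fun i j => u j i with hU
  set V : Matrix (Fin n) (Fin n) ℝ := Matrix.of fun i j => b j i with hV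
  have hVV : V * Vᵀ = 1 := mul_eq_one_comm.mp (transpose_mul_self_of_orthonormalBasis b)
  suffices h : A * V = U * rectDiag m n σ by
    rw [← h, Matrix.mul_assoc, hVV, Matrix.mul_one]
  ext i j
  have h1 : (A * V) i j = T (b j) i := by
    simp [hT, hV, mul_apply, Matrix.toLpLin_apply, mulVec, dotProduct]
  rw [h1, mul_apply]
  simp only [rectDiag_apply, hU, of_apply, mul_ite, mul_zero]
  by_cases hjm : (j : ℕ) < m
  · rw [Finset.sum_eq_single (⟨j, hjm⟩ : Fin m) (fun k _ hk => if_neg fun h => hk (Fin.ext h))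
      (by simp)]
    simp only [if_true]
    by_cases hj0 : 0 < σ j
    · rw [hu _ (show (⟨j, hjm⟩ : Fin m) ∈ s from hj0)]
      simp only [hw, Fin.is_lt, dif_pos, PiLp.smul_apply, smul_eq_mul]
      field_simp
    · have h0 : σ j = 0 := le_antisymm (not_lt.mp hj0) (singVal_nonneg A j)
      rw [hzero j h0, h0]
      simp
  · have h0 : σ j = 0 := singVal_eq_zero_of_le A ((min_le_left m n).trans (not_lt.mp hjm))
    rw [hzero j h0, Finset.sum_eq_zero fun (k : Fin m) _ => if_neg fun h : (k : ℕ) = j => hjm (h ▸ k.2)]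
    simp

lemma singVal_of_svd {U : Matrix (Fin m) (Fin m) ℝ} {V : Matrix (Fin n) (Fin n) ℝ}
    (hU : Uᵀ * U = 1) (hV : Vᵀ * V = 1) {d : ℕ → ℝ} (hd : Antitone d) (hd0 : ∀ k, 0 ≤ d k)
    {k : ℕ} (hk : k < min m n) : singVal (U * rectDiag m n d * Vᵀ) k = d k := by
  obtain ⟨U', V', hU', hV', h⟩ := exists_svd (U * rectDiag m n d * Vᵀ)
  exact (rectDiag_svd_unique hU hU' hV hV' hd (singVal_antitone _) hd0 (singVal_nonneg _) h
    hk).symm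

lemma singVal_transpose (A : Matrix (Fin m) (Fin n) ℝ) {k : ℕ} (hk : k < min m n) :
    singVal Aᵀ k = singVal A k := by
  obtain ⟨U, V, hU, hV, h⟩ := exists_svd A
  have h1 : Aᵀ = V * rectDiag n m (singVal A) * Uᵀ := by
    conv_lhs => rw [h]
    rw [transpose_mul, transpose_mul, transpose_transpose, rectDiag_transpose, Matrix.mul_assoc]
  rw [h1]
  exact singVal_of_svd hV hU (singVal_antitone A) (singVal_nonneg A) (by rwa [min_comm])

end SingularValueDecomposition

/-! ### The spectral minimizer: uniqueness, equivariance and Lipschitz bound. -/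

section SpectralThreshold

open Matrix

variable {m n : ℕ} {P : ℝ → ℝ} {c : ℝ}

lemma sum_sub_sq_eq_trace (A B : Matrix (Fin m) (Fin n) ℝ) :
    ∑ i, ∑ j, (A i j - B i j) ^ 2
      = (Aᵀ * A).trace - 2 * (Aᵀ * B).trace + (Bᵀ * B).trace := by
  simp only [trace_transpose_mul_eq_sum, Finset.mul_sum, ← Finset.sum_sub_distrib,
    ← Finset.sum_add_distrib]
  exact Finset.sum_congr rfl fun i _ => Finset.sum_congr rfl fun j _ => by ring

/-- Quadratic growth of the spectral criterion around the spectrally thresholded matrix. -/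
theorem spectralObjective_quadratic_growth (hc : 0 < c) (hP_cont : ContinuousOn P (Set.Ici 0))
    (hconv : ConvexOn ℝ (Set.Ici 0) (fun a => P a + (1 - c) / 2 * a ^ 2))
    (hP_zero : ∀ a : ℝ, 0 ≤ a → P 0 ≤ 1 / 2 * a ^ 2 + P a)
    {U : Matrix (Fin m) (Fin m) ℝ} {V : Matrix (Fin n) (Fin n) ℝ}
    (hU : Uᵀ * U = 1) (hV : Vᵀ * V = 1) {σ : ℕ → ℝ} (hσ : Antitone σ) (hσ0 : ∀ k, 0 ≤ σ k)
    (Y : Matrix (Fin m) (Fin n) ℝ) :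
    spectralObjective P (U * rectDiag m n σ * Vᵀ)
        (U * rectDiag m n (fun k => scalarThreshold P (σ k)) * Vᵀ)
      + c / 2 * ∑ i, ∑ j,
        (Y i j - (U * rectDiag m n (fun k => scalarThreshold P (σ k)) * Vᵀ) i j) ^ 2
      ≤ spectralObjective P (U * rectDiag m n σ * Vᵀ) Y := by
  have hmin := isScalarMinimizer_scalarThreshold hc hP_cont hconv hP_zero
  have hmono := @scalarThreshold_mono P c hc hP_cont hconv hP_zero
  have hs0 := scalarThreshold_zero hc hP_cont hconv hP_zero
  set s : ℕ → ℝ := fun k => scalarThreshold P (σ k) with hs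
  -- Expanding `½ ‖Y - Z‖² - c / 2 * ‖Y - X‖²`, the only term that sees the singular vectors of `Y`
  -- is its pairing with `Z - c X`. The singular values `w` of that matrix are ordered and
  -- nonnegative, so the trace inequality applies and the rest is the scalar growth summed over `k`.
  set w : ℕ → ℝ := fun k => σ k - c * s k with hw
  have hsa : Antitone s := fun i j hij => (hmono (hσ hij)).1
  have hsn : ∀ k, 0 ≤ s k := fun k => (hmin (σ k)).1
  have hwa : Antitone w := fun i j hij => (hmono (hσ hij)).2
  have hwn : ∀ k, 0 ≤ w k := fun k => by
    have := (hmono (hσ0 k)).2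
    simp only [hs0, mul_zero, sub_zero] at this
    exact this
  obtain ⟨U', V', hU', hV', hY⟩ := exists_svd Y
  set τ : ℕ → ℝ := singVal Y with hτ
  set X := U * rectDiag m n s * Vᵀ with hX
  set Z := U * rectDiag m n σ * Vᵀ with hZ
  have hW : U * rectDiag m n w * Vᵀ = Z - c • X := by
    have : rectDiag m n w = rectDiag m n σ - c • rectDiag m n s := by
      ext i j
      simp only [rectDiag_apply, Matrix.sub_apply, Matrix.smul_apply, hw, smul_eq_mul]
      split_ifs <;> simp
    rw [this, Matrix.mul_sub, Matrix.sub_mul, Matrix.mul_smul, Matrix.smul_mul]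
  have hvN : (Yᵀ * Z).trace - c * (Yᵀ * X).trace ≤ ∑ k ∈ Finset.range (min m n), τ k * w k := by
    have := trace_transpose_mul_le hU' hU hV' hV (singVal_antitone Y) hwa (singVal_nonneg Y) hwn
    rwa [← hY, hW, Matrix.mul_sub, trace_sub, Matrix.mul_smul, trace_smul, smul_eq_mul] at this
  have hYY : (Yᵀ * Y).trace = ∑ k ∈ Finset.range (min m n), τ k * τ k := by
    rw [← trace_transpose_mul_same_bases hU' hV', ← hY]
  have hXX : (Xᵀ * X).trace = ∑ k ∈ Finset.range (min m n), s k * s k :=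
    trace_transpose_mul_same_bases hU hV _ _
  have hXZ : (Xᵀ * Z).trace = ∑ k ∈ Finset.range (min m n), s k * σ k :=
    trace_transpose_mul_same_bases hU hV _ _
  have hPX : ∑ k ∈ Finset.range (min m n), P (singVal X k)
      = ∑ k ∈ Finset.range (min m n), P (s k) :=
    Finset.sum_congr rfl fun k hk => by
      rw [singVal_of_svd hU hV hsa hsn (Finset.mem_range.mp hk)]
  have hterm : ∑ k ∈ Finset.range (min m n), (1 / 2 * (s k - σ k) ^ 2 + P (s k)
        + c / 2 * (τ k - s k) ^ 2)
      ≤ ∑ k ∈ Finset.range (min m n), (1 / 2 * (τ k - σ k) ^ 2 + P (τ k)) :=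
    Finset.sum_le_sum fun k _ => (hmin (σ k)).quadratic_growth hconv (singVal_nonneg Y k)
  have e1 : ∑ k ∈ Finset.range (min m n), (1 / 2 * (s k - σ k) ^ 2 + P (s k)
        + c / 2 * (τ k - s k) ^ 2)
      = (1 + c) / 2 * (∑ k ∈ Finset.range (min m n), s k * s k)
        - (∑ k ∈ Finset.range (min m n), s k * σ k)
        + 1 / 2 * (∑ k ∈ Finset.range (min m n), σ k * σ k)
        + (∑ k ∈ Finset.range (min m n), P (s k))
        + c / 2 * (∑ k ∈ Finset.range (min m n), τ k * τ k)
        - c * (∑ k ∈ Finset.range (min m n), τ k * s k) := by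
    simp only [Finset.mul_sum, ← Finset.sum_sub_distrib, ← Finset.sum_add_distrib]
    exact Finset.sum_congr rfl fun k _ => by ring
  have e2 : ∑ k ∈ Finset.range (min m n), (1 / 2 * (τ k - σ k) ^ 2 + P (τ k))
      = 1 / 2 * (∑ k ∈ Finset.range (min m n), τ k * τ k)
        - (∑ k ∈ Finset.range (min m n), τ k * σ k)
        + 1 / 2 * (∑ k ∈ Finset.range (min m n), σ k * σ k)
        + (∑ k ∈ Finset.range (min m n), P (τ k)) := by
    simp only [Finset.mul_sum, ← Finset.sum_sub_distrib, ← Finset.sum_add_distrib]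
    exact Finset.sum_congr rfl fun k _ => by ring
  have e3 : ∑ k ∈ Finset.range (min m n), τ k * w k
      = (∑ k ∈ Finset.range (min m n), τ k * σ k)
        - c * (∑ k ∈ Finset.range (min m n), τ k * s k) := by
    simp only [Finset.mul_sum, ← Finset.sum_sub_distrib]
    exact Finset.sum_congr rfl fun k _ => by simp only [hw]; ring
  simp only [spectralObjective, sum_sub_sq_eq_trace]
  rw [hPX, hXX, hXZ, hYY]
  rw [e1, e2] at hterm
  rw [e3] at hvN
  linarith

variable (hc : 0 < c) (hP_cont : ContinuousOn P (Set.Ici 0))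
    (hconv : ConvexOn ℝ (Set.Ici 0) (fun a => P a + (1 - c) / 2 * a ^ 2))
    (hP_zero : ∀ a : ℝ, 0 ≤ a → P 0 ≤ 1 / 2 * a ^ 2 + P a)

lemma sum_sub_sq_eq_zero_iff {A B : Matrix (Fin m) (Fin n) ℝ} :
    ∑ i, ∑ j, (A i j - B i j) ^ 2 = 0 ↔ A = B := by
  rw [Finset.sum_eq_zero_iff_of_nonneg fun i _ => Finset.sum_nonneg fun j _ => sq_nonneg _]
  constructor
  · intro h
    ext i j
    have h1 := h i (Finset.mem_univ i)
    rw [Finset.sum_eq_zero_iff_of_nonneg fun j _ => sq_nonneg _] at h1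
    exact sub_eq_zero.mp (pow_eq_zero_iff two_ne_zero |>.mp (h1 j (Finset.mem_univ j)))
  · rintro rfl i -
    simp

include hc hP_cont hconv hP_zero

/-- The spectral minimizers at a matrix with a given singular value decomposition. -/
theorem isSpectralMinimizer_svd_iff
    {U : Matrix (Fin m) (Fin m) ℝ} {V : Matrix (Fin n) (Fin n) ℝ}
    (hU : Uᵀ * U = 1) (hV : Vᵀ * V = 1) {σ : ℕ → ℝ} (hσ : Antitone σ) (hσ0 : ∀ k, 0 ≤ σ k)
    (X : Matrix (Fin m) (Fin n) ℝ) :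
    IsSpectralMinimizer P (U * rectDiag m n σ * Vᵀ) X
      ↔ X = U * rectDiag m n (fun k => scalarThreshold P (σ k)) * Vᵀ := by
  have hgrow := spectralObjective_quadratic_growth hc hP_cont hconv hP_zero hU hV hσ hσ0
  constructor
  · intro hX
    have h1 := hgrow X
    have h2 := hX (U * rectDiag m n (fun k => scalarThreshold P (σ k)) * Vᵀ)
    refine sum_sub_sq_eq_zero_iff.mp (le_antisymm ?_
      (Finset.sum_nonneg fun i _ => Finset.sum_nonneg fun j _ => sq_nonneg _))
    exact nonpos_of_mul_nonpos_right (by linarith) (half_pos hc)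
  · rintro rfl Y
    refine le_trans (le_add_of_nonneg_right ?_) (hgrow Y)
    exact mul_nonneg (half_pos hc).le
      (Finset.sum_nonneg fun i _ => Finset.sum_nonneg fun j _ => sq_nonneg _)

theorem spectralThreshold_svd
    {U : Matrix (Fin m) (Fin m) ℝ} {V : Matrix (Fin n) (Fin n) ℝ}
    (hU : Uᵀ * U = 1) (hV : Vᵀ * V = 1) {σ : ℕ → ℝ} (hσ : Antitone σ) (hσ0 : ∀ k, 0 ≤ σ k) :
    spectralThreshold P (U * rectDiag m n σ * Vᵀ)
      = U * rectDiag m n (fun k => scalarThreshold P (σ k)) * Vᵀ := by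
  have h := isSpectralMinimizer_svd_iff hc hP_cont hconv hP_zero hU hV hσ hσ0
  exact (h _).mp (Classical.epsilon_spec ⟨_, (h _).mpr rfl⟩)

theorem isSpectralMinimizer_iff (A X : Matrix (Fin m) (Fin n) ℝ) :
    IsSpectralMinimizer P A X ↔ X = spectralThreshold P A := by
  obtain ⟨U, V, hU, hV, hA⟩ := exists_svd A
  rw [hA, spectralThreshold_svd hc hP_cont hconv hP_zero hU hV (singVal_antitone A)
    (singVal_nonneg A)]
  exact isSpectralMinimizer_svd_iff hc hP_cont hconv hP_zero hU hV (singVal_antitone A)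
    (singVal_nonneg A) X

/-- Conjugation carries a singular value decomposition of `A` to one of `U * A * Vᵀ` with the same
singular values. This equivariance is what determines the derivative in off-diagonal directions. -/
lemma spectralThreshold_conj {U : Matrix (Fin m) (Fin m) ℝ} {V : Matrix (Fin n) (Fin n) ℝ}
    (hU : Uᵀ * U = 1) (hV : Vᵀ * V = 1) (A : Matrix (Fin m) (Fin n) ℝ) :
    spectralThreshold P (U * A * Vᵀ) = U * spectralThreshold P A * Vᵀ := by
  obtain ⟨U', V', hU', hV', hA⟩ := exists_svd A
  have h1 := @spectralThreshold_svd m n P c hc hP_cont hconv hP_zero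
  have h2 : ∀ d, U * (U' * rectDiag m n d * V'ᵀ) * Vᵀ
      = (U * U') * rectDiag m n d * (V * V')ᵀ := by
    intro d
    rw [transpose_mul]
    simp only [Matrix.mul_assoc]
  rw [hA, h2, h1 hU' hV' (singVal_antitone A) (singVal_nonneg A), h2,
    h1 _ _ (singVal_antitone A) (singVal_nonneg A)]
  · rw [transpose_mul, Matrix.mul_assoc, ← Matrix.mul_assoc Uᵀ, hU, Matrix.one_mul, hU']
  · rw [transpose_mul, Matrix.mul_assoc, ← Matrix.mul_assoc Vᵀ, hV, Matrix.one_mul, hV']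

/-- The spectral thresholding operator is Lipschitz in the Frobenius norm. -/
theorem spectralThreshold_lipschitz (A B : Matrix (Fin m) (Fin n) ℝ) :
    c ^ 2 * ∑ i, ∑ j, (spectralThreshold P A i j - spectralThreshold P B i j) ^ 2
      ≤ ∑ i, ∑ j, (A i j - B i j) ^ 2 := by
  have hgrow : ∀ A Y : Matrix (Fin m) (Fin n) ℝ,
      spectralObjective P A (spectralThreshold P A)
        + c / 2 * ∑ i, ∑ j, (Y i j - spectralThreshold P A i j) ^ 2 ≤ spectralObjective P A Y := by
    intro A Y
    obtain ⟨U, V, hU, hV, hA⟩ := exists_svd A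
    have h1 := spectralThreshold_svd hc hP_cont hconv hP_zero hU hV (singVal_antitone A)
      (singVal_nonneg A)
    have h2 := spectralObjective_quadratic_growth hc hP_cont hconv hP_zero hU hV
      (singVal_antitone A) (singVal_nonneg A) Y
    rwa [← h1, ← hA] at h2
  have h1 := hgrow A (spectralThreshold P B)
  have h2 := hgrow B (spectralThreshold P A)
  set X := spectralThreshold P A
  set Y := spectralThreshold P B
  simp only [spectralObjective] at h1 h2
  have h3 : ∑ i, ∑ j, (Y i j - X i j) ^ 2 = ∑ i, ∑ j, (X i j - Y i j) ^ 2 :=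
    Finset.sum_congr rfl fun i _ => Finset.sum_congr rfl fun j _ => by ring
  -- The left side equals `⟨A - B, X - Y⟩ - c ‖X - Y‖²`, which the two growth inequalities make
  -- nonnegative; the right side completes the square.
  have h4 : 1 / 2 * (∑ i, ∑ j, (Y i j - A i j) ^ 2) + 1 / 2 * (∑ i, ∑ j, (X i j - B i j) ^ 2)
      - 1 / 2 * (∑ i, ∑ j, (X i j - A i j) ^ 2) - 1 / 2 * (∑ i, ∑ j, (Y i j - B i j) ^ 2)
      - c * (∑ i, ∑ j, (X i j - Y i j) ^ 2)
      = 1 / (2 * c) * (∑ i, ∑ j, (A i j - B i j) ^ 2)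
        - c / 2 * (∑ i, ∑ j, (X i j - Y i j) ^ 2)
        - 1 / (2 * c) * (∑ i, ∑ j, ((A i j - B i j) - c * (X i j - Y i j)) ^ 2) := by
    simp only [Finset.mul_sum, ← Finset.sum_sub_distrib, ← Finset.sum_add_distrib]
    refine Finset.sum_congr rfl fun i _ => Finset.sum_congr rfl fun j _ => ?_
    field_simp
    ring
  have h5 : 0 ≤ 1 / (2 * c) * (∑ i, ∑ j, ((A i j - B i j) - c * (X i j - Y i j)) ^ 2) := by
    positivity
  have h6 : c / 2 * (∑ i, ∑ j, (X i j - Y i j) ^ 2)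
      ≤ 1 / (2 * c) * (∑ i, ∑ j, (A i j - B i j) ^ 2) := by
    rw [h3] at h1
    linarith
  have h7 := mul_le_mul_of_nonneg_left h6 (by positivity : 0 ≤ 2 * c)
  have h8 : 2 * c * (1 / (2 * c) * (∑ i, ∑ j, (A i j - B i j) ^ 2))
      = ∑ i, ∑ j, (A i j - B i j) ^ 2 := by
    field_simp
  linarith

end SpectralThreshold

/-! ### Almost every matrix has positive, pairwise distinct singular values. -/

section SimpleSpectrum

open Matrix

/-- The determinant of the Krylov matrix whose columns are `W ^ (k + 1) 1`, where `W = A Aᵀ`. -/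
noncomputable def krylovDet {R : Type*} [CommRing R] {m n : ℕ} (A : Matrix (Fin m) (Fin n) R) : R :=
  (Matrix.of fun (i : Fin m) (k : Fin m) => (((A * Aᵀ) ^ ((k : ℕ) + 1)) *ᵥ 1) i).det

variable {m n : ℕ}

/-- Allows the determinant to be computed over `Polynomial ℝ` and then evaluated, so that along a
line of matrices it is a polynomial in the parameter. -/
lemma krylovDet_map {R S : Type*} [CommRing R] [CommRing S] (f : R →+* S)
    (A : Matrix (Fin m) (Fin n) R) : f (krylovDet A) = krylovDet (A.map f) := by
  rw [krylovDet, krylovDet, RingHom.map_det]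
  congr 1
  ext i k
  have h : (A.map f * (A.map f)ᵀ) ^ ((k : ℕ) + 1) = ((A * Aᵀ) ^ ((k : ℕ) + 1)).map f := by
    rw [← transpose_map, ← Matrix.map_mul]
    exact (map_pow f.mapMatrix _ _).symm
  simp only [RingHom.mapMatrix_apply, map_apply, of_apply, h]
  simp [mulVec, dotProduct]

lemma krylovDet_smul {R : Type*} [CommRing R] (c : R) (A : Matrix (Fin m) (Fin n) R) :
    krylovDet (c • A) = (∏ k : Fin m, (c * c) ^ ((k : ℕ) + 1)) * krylovDet A := by
  rw [krylovDet, krylovDet, ← det_mul_row]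
  congr 1
  ext i k
  simp [transpose_smul, Matrix.smul_mul, Matrix.mul_smul, smul_smul, smul_pow, smul_mulVec]

/-- Since `A Aᵀ = U diag(d²) Uᵀ`, the Krylov matrix factors as `U` times two diagonal matrices times
a Vandermonde matrix in the `d i ^ 2`. Starting the powers at exponent one supplies the factor `∏ d
i ^ 2`, so nonvanishing excludes zero as well as repeated singular values. -/
lemma krylovDet_svd (hmn : m ≤ n) {U : Matrix (Fin m) (Fin m) ℝ} {V : Matrix (Fin n) (Fin n) ℝ}
    (hU : Uᵀ * U = 1) (hV : Vᵀ * V = 1) (d : ℕ → ℝ) :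
    krylovDet (U * rectDiag m n d * Vᵀ)
      = U.det * ((∏ i : Fin m, (Uᵀ *ᵥ 1) i * d i ^ 2)
        * (vandermonde fun i : Fin m => d i ^ 2).det) := by
  have hD : rectDiag m n d * (rectDiag m n d)ᵀ = diagonal fun i : Fin m => d i ^ 2 := by
    ext i j
    rw [mul_apply, Finset.sum_eq_single (i.castLE hmn)]
    · simp only [transpose_apply, rectDiag_apply, Fin.val_castLE, if_true, diagonal_apply,
        Fin.ext_iff, eq_comm (a := (j : ℕ))]
      split_ifs with h
      · rw [h, sq]
      · simp
    · intro k _ hk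
      rw [rectDiag_apply, if_neg fun h => hk (Fin.ext h.symm), zero_mul]
    · simp
  have hW : (U * rectDiag m n d * Vᵀ) * (U * rectDiag m n d * Vᵀ)ᵀ
      = U * (diagonal fun i : Fin m => d i ^ 2) * Uᵀ := by
    rw [← hD, transpose_mul, transpose_transpose, transpose_mul]
    calc U * rectDiag m n d * Vᵀ * (V * ((rectDiag m n d)ᵀ * Uᵀ))
        = U * rectDiag m n d * (Vᵀ * V) * (rectDiag m n d)ᵀ * Uᵀ := by
          simp only [Matrix.mul_assoc]
      _ = _ := by rw [hV, Matrix.mul_one]; simp only [Matrix.mul_assoc]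
  have hpow : ∀ k : ℕ, (U * (diagonal fun i : Fin m => d i ^ 2) * Uᵀ) ^ (k + 1)
      = U * (diagonal fun i : Fin m => (d i ^ 2) ^ (k + 1)) * Uᵀ := by
    intro k
    induction k with
    | zero => simp
    | succ k ih =>
      rw [pow_succ, ih]
      calc U * (diagonal fun i : Fin m => (d i ^ 2) ^ (k + 1)) * Uᵀ
            * (U * (diagonal fun i : Fin m => d i ^ 2) * Uᵀ)
          = U * (diagonal fun i : Fin m => (d i ^ 2) ^ (k + 1)) * (Uᵀ * U)
            * (diagonal fun i : Fin m => d i ^ 2) * Uᵀ := by simp only [Matrix.mul_assoc]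
        _ = _ := by
          rw [hU, Matrix.mul_one, Matrix.mul_assoc U, diagonal_mul_diagonal]
          simp only [← pow_succ]
  rw [← det_mul_column, ← det_mul, krylovDet]
  congr 1
  ext i k
  rw [of_apply, hW, hpow, Matrix.mul_assoc, ← mulVec_mulVec, ← mulVec_mulVec, mul_apply]
  simp only [mulVec, dotProduct, diagonal_apply, ite_mul, zero_mul, Finset.sum_ite_eq,
    Finset.mem_univ, if_true, of_apply, vandermonde_apply]
  exact Finset.sum_congr rfl fun j _ => by ring

lemma singVal_pos_of_krylovDet_ne_zero (hmn : m ≤ n) {A : Matrix (Fin m) (Fin n) ℝ}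
    (hA : krylovDet A ≠ 0) {i : ℕ} (hi : i < m) :
    0 < singVal A i ∧ ∀ j < m, i ≠ j → singVal A i ≠ singVal A j := by
  obtain ⟨U, V, hU, hV, h⟩ := exists_svd A
  rw [h, krylovDet_svd hmn hU hV] at hA
  have h1 := right_ne_zero_of_mul hA
  have h2 := Finset.prod_ne_zero_iff.mp (left_ne_zero_of_mul h1)
  have h3 := det_vandermonde_ne_zero_iff.mp (right_ne_zero_of_mul h1)
  constructor
  · refine (singVal_nonneg A i).lt_of_ne' fun h0 => h2 ⟨i, hi⟩ (Finset.mem_univ _) ?_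
    simp [h0]
  · intro j hj hij heq
    have := @h3 ⟨i, hi⟩ ⟨j, hj⟩ (by simp only [heq])
    exact hij (by simpa using this)

lemma exists_krylovDet_ne_zero (hmn : m ≤ n) : ∃ A : Matrix (Fin m) (Fin n) ℝ, krylovDet A ≠ 0 := by
  -- The entries need only be nonzero with distinct squares; the factorization requires no ordering.
  refine ⟨(1 : Matrix (Fin m) (Fin m) ℝ) * rectDiag m n (fun k => (k : ℝ) + 1) * (1 : Matrix (Fin n) (Fin n) ℝ)ᵀ, ?_⟩
  rw [krylovDet_svd hmn (by simp) (by simp)]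
  refine mul_ne_zero (by simp) (mul_ne_zero (Finset.prod_ne_zero_iff.mpr fun i _ => ?_)
    (det_vandermonde_ne_zero_iff.mpr fun i j hij => ?_))
  · have : (0 : ℝ) < (i : ℕ) + 1 := by positivity
    simp [this.ne']
  · have h1 : ((i : ℕ) : ℝ) + 1 = (j : ℕ) + 1 :=
      (sq_eq_sq₀ (by positivity) (by positivity)).mp hij
    exact Fin.ext (by exact_mod_cast add_right_cancel h1)

/-- For `t ≠ 0`, homogeneity reduces to `t⁻¹ • B + A`. The polynomial in `t⁻¹` so obtained has
constant term `krylovDet A ≠ 0`, hence finitely many roots. -/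
lemma finite_krylovDet_add_smul_eq_zero {A : Matrix (Fin m) (Fin n) ℝ} (hA : krylovDet A ≠ 0)
    (B : Matrix (Fin m) (Fin n) ℝ) : {t : ℝ | krylovDet (B + t • A) = 0}.Finite := by
  set q : Polynomial ℝ := krylovDet ((Polynomial.X : Polynomial ℝ) • B.map Polynomial.C
    + A.map Polynomial.C) with hq
  have heval : ∀ s : ℝ, q.eval s = krylovDet (s • B + A) := by
    intro s
    rw [← Polynomial.coe_evalRingHom, hq, krylovDet_map]
    congr 1
    ext i j
    simp [mul_comm s]
  have hq0 : q ≠ 0 := by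
    intro h
    have := heval 0
    rw [h, Polynomial.eval_zero, zero_smul, zero_add] at this
    exact hA this.symm
  refine ((Set.finite_singleton (0 : ℝ)).union
    ((q.roots.toFinset.finite_toSet).image fun s => s⁻¹)).subset fun t ht => ?_
  by_cases ht0 : t = 0
  · exact Or.inl ht0
  · right
    refine ⟨t⁻¹, ?_, inv_inv t⟩
    have h1 : B + t • A = t • (t⁻¹ • B + A) := by
      rw [smul_add, smul_smul, mul_inv_cancel₀ ht0, one_smul]
    have h2 : krylovDet (B + t • A) = 0 := ht
    rw [h1, krylovDet_smul] at h2
    have h3 := (mul_eq_zero.mp h2).resolve_left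
      (Finset.prod_ne_zero_iff.mpr fun k _ => pow_ne_zero _ (mul_ne_zero ht0 ht0))
    simp [hq0, Polynomial.IsRoot.def, heval, h3]

/-- The matrix whose entries are listed by a function on pairs of indices. -/
def matrixOfPairs (z : Fin m × Fin n → ℝ) : Matrix (Fin m) (Fin n) ℝ :=
  Matrix.of fun i j => z (i, j)

lemma continuous_matrixOfPairs :
    Continuous (matrixOfPairs : (Fin m × Fin n → ℝ) → Matrix (Fin m) (Fin n) ℝ) :=
  continuous_matrix fun i j => continuous_apply (i, j)

lemma continuous_krylovDet : Continuous (krylovDet : Matrix (Fin m) (Fin n) ℝ → ℝ) := by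
  refine Continuous.matrix_det (continuous_matrix fun i k => ?_)
  exact (continuous_apply i).comp (Continuous.matrix_mulVec
    ((continuous_id.matrix_mul continuous_id.matrix_transpose).pow _) continuous_const)

/-- Outside a null set of matrices, the singular values are positive and pairwise distinct. -/
theorem ae_singVal_pos_and_ne : ∀ᵐ z : Fin m × Fin n → ℝ, ∀ i < min m n,
    0 < singVal (matrixOfPairs z) i ∧
      ∀ j < min m n, i ≠ j → singVal (matrixOfPairs z) i ≠ singVal (matrixOfPairs z) j := by
  have key : ∀ {p q : ℕ} (f : (Fin m × Fin n → ℝ) → Matrix (Fin p) (Fin q) ℝ)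
      (_ : Continuous f) (_ : ∀ z w (t : ℝ), f (z + t • w) = f z + t • f w)
      (_ : Function.Surjective f) (_ : p ≤ q),
      ∀ᵐ z : Fin m × Fin n → ℝ, krylovDet (f z) ≠ 0 := by
    intro p q f hf hlin hsurj hpq
    obtain ⟨A, hA⟩ := exists_krylovDet_ne_zero hpq
    obtain ⟨a, ha⟩ := hsurj A
    -- Every line in the direction `a` meets the zero set in finitely many points, so that set is
    -- null.
    refine ae_mem_of_ae_add_linearMap_mem ((LinearMap.id : ℝ →ₗ[ℝ] ℝ).smulRight a) volume volume
      (s := {z | krylovDet (f z) ≠ 0}) ?_ fun y => ?_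
    · exact (isOpen_ne_fun (continuous_krylovDet.comp hf) continuous_const).measurableSet
    · have h1 := (finite_krylovDet_add_smul_eq_zero hA (f y)).measure_zero volume
      refine measure_mono_null ?_ h1
      intro t ht
      simpa [hlin, ha] using ht
  rcases le_total m n with hmn | hmn
  · filter_upwards [key matrixOfPairs continuous_matrixOfPairs (fun z w t => rfl)
      (fun A => ⟨fun p => A p.1 p.2, rfl⟩) hmn] with z hz i hi
    rw [min_eq_left hmn] at hi ⊢
    exact singVal_pos_of_krylovDet_ne_zero hmn hz hi
  · filter_upwards [key (fun z => (matrixOfPairs z)ᵀ) continuous_matrixOfPairs.matrix_transpose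
      (fun z w t => rfl) (fun A => ⟨fun p => A p.2 p.1, rfl⟩) hmn] with z hz i hi
    rw [← singVal_transpose _ hi]
    have h := singVal_pos_of_krylovDet_ne_zero hmn hz (lt_of_lt_of_eq hi (min_eq_right hmn))
    refine ⟨h.1, fun j hj hij => ?_⟩
    rw [← singVal_transpose _ hj]
    exact h.2 j (lt_of_lt_of_eq hj (min_eq_right hmn)) hij

end SimpleSpectrum

/-! ### Entries of the derivative of spectral thresholding. -/

section Divergence

open Matrix

variable {m n : ℕ}

/-- The list of entries of a matrix, as a function on pairs of indices. -/
def pairsOfMatrix (A : Matrix (Fin m) (Fin n) ℝ) : Fin m × Fin n → ℝ := fun p => A p.1 p.2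

@[simp] lemma matrixOfPairs_pairsOfMatrix (A : Matrix (Fin m) (Fin n) ℝ) :
    matrixOfPairs (pairsOfMatrix A) = A := rfl

@[simp] lemma pairsOfMatrix_matrixOfPairs (z : Fin m × Fin n → ℝ) :
    pairsOfMatrix (matrixOfPairs z) = z := rfl

/-- The spectral thresholding operator acting on lists of matrix entries. -/
noncomputable def thresholdPairs (P : ℝ → ℝ) (z : Fin m × Fin n → ℝ) : Fin m × Fin n → ℝ :=
  pairsOfMatrix (spectralThreshold P (matrixOfPairs z))

/-- The generator of the rotations in a coordinate plane. -/
def planeGenerator (k l : Fin m) : Matrix (Fin m) (Fin m) ℝ :=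
  Matrix.single k l (1 : ℝ) - Matrix.single l k (1 : ℝ)

lemma planeGenerator_mul_apply (k l : Fin m) (A : Matrix (Fin m) (Fin n) ℝ) (i : Fin m)
    (j : Fin n) : (planeGenerator k l * A) i j
      = (if i = k then A l j else 0) - (if i = l then A k j else 0) := by
  rw [planeGenerator, Matrix.sub_mul, Matrix.sub_apply]
  simp [mul_apply, Matrix.single_apply, ite_and, eq_comm]

lemma mul_planeGenerator_apply (k l : Fin n) (A : Matrix (Fin m) (Fin n) ℝ) (i : Fin m)
    (j : Fin n) : (A * planeGenerator k l) i j
      = (if j = l then A i k else 0) - (if j = k then A i l else 0) := by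
  rw [planeGenerator, Matrix.mul_sub, Matrix.sub_apply]
  simp [mul_apply, Matrix.single_apply, ite_and, eq_comm]

/-- A rotation in a coordinate plane, with its derivative at the identity. -/
lemma exists_rotation {k l : Fin m} (hkl : k ≠ l) :
    ∃ R : ℝ → Matrix (Fin m) (Fin m) ℝ, (∀ t, (R t)ᵀ * R t = 1) ∧ R 0 = 1 ∧
      ∀ i j, HasDerivAt (fun t => R t i j)
        (planeGenerator k l i j) 0 := by
  set J : Matrix (Fin m) (Fin m) ℝ := planeGenerator k l
  have hJ : J = Matrix.single k l (1 : ℝ) - Matrix.single l k (1 : ℝ) := rfl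
  set Q : Matrix (Fin m) (Fin m) ℝ := Matrix.single k k (1 : ℝ) + Matrix.single l l 1 with hQ
  have hJt : Jᵀ = -J := by simp [hJ]
  have hQt : Qᵀ = Q := by simp [hQ]
  have hJJ : J * J = -Q := by
    simp [hJ, hQ, Matrix.sub_mul, Matrix.mul_sub, hkl, hkl.symm]
    abel
  have hQQ : Q * Q = Q := by
    simp [hQ, Matrix.add_mul, Matrix.mul_add, hkl, hkl.symm]
  have hQJ : Q * J = J := by
    simp [hJ, hQ, Matrix.add_mul, Matrix.mul_sub, hkl, hkl.symm]
  have hJQ : J * Q = J := by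
    simp [hJ, hQ, Matrix.sub_mul, Matrix.mul_add, hkl, hkl.symm]
    abel
  -- This is `exp (t J)`, with `Q = -J²` the projection onto the coordinate plane.
  refine ⟨fun t => 1 + Real.sin t • J + (Real.cos t - 1) • Q, fun t => ?_, by simp, fun i j => ?_⟩
  · have h1 := Real.sin_sq_add_cos_sq t
    simp only [transpose_add, transpose_smul, transpose_one, hJt, hQt, Matrix.add_mul,
      Matrix.mul_add, Matrix.one_mul, Matrix.mul_one, Matrix.smul_mul, Matrix.mul_smul,
      Matrix.neg_mul, hJJ, hQQ, hQJ, hJQ, neg_neg, smul_neg]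
    match_scalars
    · ring
    · ring
    · linear_combination h1
    · linear_combination h1
  · have h1 : HasDerivAt (fun t => (1 : Matrix (Fin m) (Fin m) ℝ) i j + Real.sin t * J i j
        + (Real.cos t - 1) * Q i j) (Real.cos 0 * J i j + (-Real.sin 0) * Q i j) 0 :=
      (((Real.hasDerivAt_sin 0).mul_const (J i j)).const_add _).add
        (((Real.hasDerivAt_cos 0).sub_const 1).mul_const (Q i j))
    simpa using h1

variable {P : ℝ → ℝ} {c : ℝ}

section Derivative

variable (hc : 0 < c) (hP_cont : ContinuousOn P (Set.Ici 0))
    (hconv : ConvexOn ℝ (Set.Ici 0) (fun a => P a + (1 - c) / 2 * a ^ 2))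
    (hP_zero : ∀ a : ℝ, 0 ≤ a → P 0 ≤ 1 / 2 * a ^ 2 + P a)

include hc hP_cont hconv hP_zero

lemma exists_lipschitzWith_thresholdPairs :
    ∃ K : ℝ≥0, LipschitzWith K (thresholdPairs P : (Fin m × Fin n → ℝ) → _) := by
  -- The function space carries the sup norm; passing from it to the Frobenius norm costs `√(m *
  -- n)`.
  refine ⟨⟨√(m * n) / c, by positivity⟩, LipschitzWith.of_dist_le_mul fun z w => ?_⟩
  have hKd : 0 ≤ √(m * n) / c * dist z w := by positivity
  refine (dist_pi_le_iff hKd).mpr ?_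
  rintro ⟨i, j⟩
  rw [Real.dist_eq]
  refine abs_le_of_sq_le_sq ?_ hKd
  have h1 := spectralThreshold_lipschitz hc hP_cont hconv hP_zero (matrixOfPairs z)
    (matrixOfPairs w)
  set X := spectralThreshold P (matrixOfPairs z)
  set Y := spectralThreshold P (matrixOfPairs w)
  have h2 : (X i j - Y i j) ^ 2 ≤ ∑ i, ∑ j, (X i j - Y i j) ^ 2 :=
    (Finset.single_le_sum (f := fun j => (X i j - Y i j) ^ 2) (fun _ _ => sq_nonneg _)
      (Finset.mem_univ j)).trans
    (Finset.single_le_sum (f := fun i => ∑ j, (X i j - Y i j) ^ 2)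
      (fun _ _ => Finset.sum_nonneg fun _ _ => sq_nonneg _) (Finset.mem_univ i))
  have h3 : ∑ i, ∑ j, (matrixOfPairs z i j - matrixOfPairs w i j) ^ 2
      ≤ ∑ _i : Fin m, ∑ _j : Fin n, dist z w ^ 2 := by
    refine Finset.sum_le_sum fun i _ => Finset.sum_le_sum fun j _ => ?_
    have := dist_le_pi_dist z w (i, j)
    rw [Real.dist_eq] at this
    rw [← sq_abs]
    exact pow_le_pow_left₀ (abs_nonneg _) this 2
  simp only [Finset.sum_const, Finset.card_univ, Fintype.card_fin, nsmul_eq_mul] at h3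
  have h4 : (√(m * n) / c * dist z w) ^ 2 = (m * (n * dist z w ^ 2)) / c ^ 2 := by
    rw [mul_pow, div_pow, Real.sq_sqrt (by positivity)]
    ring
  change (X i j - Y i j) ^ 2 ≤ _
  rw [h4, le_div_iff₀ (by positivity)]
  nlinarith [mul_le_mul_of_nonneg_left h2 (sq_nonneg c)]

lemma spectralThreshold_rectDiag {σ : ℕ → ℝ} (hσ : Antitone σ) (hσ0 : ∀ k, 0 ≤ σ k) :
    spectralThreshold P (rectDiag m n σ) = rectDiag m n (fun k => scalarThreshold P (σ k)) := by
  simpa using spectralThreshold_svd (m := m) (n := n) (U := 1) (V := 1) hc hP_cont hconv hP_zero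
    (by simp) (by simp) hσ hσ0

variable {L : (Fin m × Fin n → ℝ) →L[ℝ] (Fin m × Fin n → ℝ)} {A : Matrix (Fin m) (Fin n) ℝ}

/-- The derivative of spectral thresholding along rotations of the column space. -/
lemma thresholdPairs_fderiv_rotation_left (hL : HasFDerivAt (thresholdPairs P) L (pairsOfMatrix A))
    {k l : Fin m} (hkl : k ≠ l) :
    L (pairsOfMatrix (planeGenerator k l * A))
      = pairsOfMatrix (planeGenerator k l * spectralThreshold P A) := by
  obtain ⟨R, hR, hR0, hRd⟩ := exists_rotation hkl
  set J : Matrix (Fin m) (Fin m) ℝ := planeGenerator k l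
  have hcurve : ∀ X : Matrix (Fin m) (Fin n) ℝ,
      HasDerivAt (fun t => pairsOfMatrix (R t * X)) (pairsOfMatrix (J * X)) 0 := by
    intro X
    rw [hasDerivAt_pi]
    rintro ⟨i, j⟩
    simp only [pairsOfMatrix, mul_apply]
    exact HasDerivAt.fun_sum fun p _ => (hRd i p).mul_const (X p j)
  have h0 : pairsOfMatrix (R 0 * A) = pairsOfMatrix A := by rw [hR0, Matrix.one_mul]
  have h1 := (h0 ▸ hL).comp_hasDerivAt (0 : ℝ) (hcurve A)
  have h2 : (thresholdPairs P ∘ fun t => pairsOfMatrix (R t * A))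
      = fun t => pairsOfMatrix (R t * spectralThreshold P A) := by
    funext t
    have := spectralThreshold_conj (V := (1 : Matrix (Fin n) (Fin n) ℝ)) hc hP_cont hconv hP_zero
      (hR t) (by simp) A
    simp only [transpose_one, Matrix.mul_one] at this
    simp only [Function.comp_apply, thresholdPairs, matrixOfPairs_pairsOfMatrix, this]
  rw [h2] at h1
  exact h1.unique (hcurve (spectralThreshold P A))

/-- The derivative of spectral thresholding along rotations of the row space. -/
lemma thresholdPairs_fderiv_rotation_right (hL : HasFDerivAt (thresholdPairs P) L (pairsOfMatrix A))
    {k l : Fin n} (hkl : k ≠ l) :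
    L (pairsOfMatrix (A * planeGenerator k l))
      = pairsOfMatrix (spectralThreshold P A * planeGenerator k l) := by
  obtain ⟨R, hR, hR0, hRd⟩ := exists_rotation hkl
  set J : Matrix (Fin n) (Fin n) ℝ := planeGenerator k l
  have hcurve : ∀ X : Matrix (Fin m) (Fin n) ℝ,
      HasDerivAt (fun t => pairsOfMatrix (X * R t)) (pairsOfMatrix (X * J)) 0 := by
    intro X
    rw [hasDerivAt_pi]
    rintro ⟨i, j⟩
    simp only [pairsOfMatrix, mul_apply]
    exact HasDerivAt.fun_sum fun p _ => (hRd p j).const_mul (X i p)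
  have h0 : pairsOfMatrix (A * R 0) = pairsOfMatrix A := by rw [hR0, Matrix.mul_one]
  have h1 := (h0 ▸ hL).comp_hasDerivAt (0 : ℝ) (hcurve A)
  have h2 : (thresholdPairs P ∘ fun t => pairsOfMatrix (A * R t))
      = fun t => pairsOfMatrix (spectralThreshold P A * R t) := by
    funext t
    have := spectralThreshold_conj (U := (1 : Matrix (Fin m) (Fin m) ℝ)) (V := (R t)ᵀ)
      hc hP_cont hconv hP_zero (by simp)
      (by rw [transpose_transpose]; exact mul_eq_one_comm.mp (hR t)) A
    simp only [transpose_transpose, Matrix.one_mul] at this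
    simp only [Function.comp_apply, thresholdPairs, matrixOfPairs_pairsOfMatrix, this]
  rw [h2] at h1
  exact h1.unique (hcurve (spectralThreshold P A))

/-- The strict gaps keep the diagonal ordered while its `k`-th entry alone moves near `σ k`. On that
curve the `(k, k)` entry of the thresholded matrix is the scalar threshold, so the chain rule gives
its derivative. -/
lemma hasDerivAt_scalarThreshold {σ : ℕ → ℝ} (hσ : Antitone σ) (hσ0 : ∀ k, 0 ≤ σ k)
    (hL : HasFDerivAt (thresholdPairs P) L (pairsOfMatrix (rectDiag m n σ)))
    {k : ℕ} (hkm : k < m) (hkn : k < n) (hlt : σ (k + 1) < σ k) (hgt : ∀ j < k, σ k < σ j) :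
    HasDerivAt (scalarThreshold P)
      (L (Pi.single (⟨k, hkm⟩, ⟨k, hkn⟩) 1) (⟨k, hkm⟩, ⟨k, hkn⟩)) (σ k) := by
  set p : Fin m × Fin n := (⟨k, hkm⟩, ⟨k, hkn⟩) with hp
  set γ : ℝ → Fin m × Fin n → ℝ := fun t =>
    pairsOfMatrix (rectDiag m n σ) + (t - σ k) • Pi.single p (1 : ℝ) with hγ
  have hγd : HasDerivAt γ (Pi.single p (1 : ℝ)) (σ k) :=
    ((((hasDerivAt_id (σ k)).sub_const (σ k)).smul_const
      (Pi.single p (1 : ℝ) : Fin m × Fin n → ℝ)).const_add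
        (pairsOfMatrix (rectDiag m n σ))).congr_deriv (one_smul _ _)
  have hγ0 : γ (σ k) = pairsOfMatrix (rectDiag m n σ) := by simp [hγ]
  have h1 := hasDerivAt_pi.mp ((hγ0 ▸ hL).comp_hasDerivAt (σ k) hγd) p
  refine h1.congr_of_eventuallyEq ?_
  have hγt : ∀ t, γ t = pairsOfMatrix (rectDiag m n (Function.update σ k t)) := by
    intro t
    funext ⟨i, j⟩
    simp only [hγ, Pi.add_apply, Pi.smul_apply, smul_eq_mul, pairsOfMatrix, rectDiag_apply,
      Pi.single_apply, hp, Prod.mk.injEq, Fin.ext_iff, Function.update_apply]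
    by_cases hij : (i : ℕ) = j
    · by_cases hik : (i : ℕ) = k
      · simp [hik, ← hij]
      · have hjk : ¬ (j : ℕ) = k := hij ▸ hik
        simp [hjk, hij]
    · have : ¬ ((i : ℕ) = k ∧ (j : ℕ) = k) := fun h => hij (h.1.trans h.2.symm)
      simp [hij, this]
  have hev : ∀ᶠ t in nhds (σ k), σ (k + 1) < t ∧ ∀ j ∈ Finset.range k, t < σ j :=
    (lt_mem_nhds hlt).and <| (Filter.eventually_all_finset _).mpr fun j hj =>
      gt_mem_nhds (hgt j (Finset.mem_range.mp hj))
  filter_upwards [hev] with t ht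
  have hanti : Antitone (Function.update σ k t) := by
    refine antitone_nat_of_succ_le fun i => ?_
    simp only [Function.update_apply]
    split_ifs with h1 h2 h2
    · omega
    · exact (ht.2 i (Finset.mem_range.mpr (by omega))).le
    · exact h2 ▸ ht.1.le
    · exact hσ i.le_succ
  have hnn : ∀ i, 0 ≤ Function.update σ k t i := by
    intro i
    simp only [Function.update_apply]
    split_ifs
    · exact (hσ0 _).trans ht.1.le
    · exact hσ0 i
  simp only [Function.comp_apply, hγt, thresholdPairs, matrixOfPairs_pairsOfMatrix]
  rw [spectralThreshold_rectDiag hc hP_cont hconv hP_zero hanti hnn]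
  simp [pairsOfMatrix, rectDiag_apply, hp]

/-- The left and right rotations in the plane of `k` and `l` move a diagonal matrix in two
combinations of the matrix units at `(k, l)` and `(l, k)`. Equivariance gives the image of each
combination, and the unknown attached to `(l, k)` is eliminated. -/
lemma fderiv_thresholdPairs_square {σ : ℕ → ℝ} (hσ : Antitone σ) (hσ0 : ∀ k, 0 ≤ σ k)
    (hL : HasFDerivAt (thresholdPairs P) L (pairsOfMatrix (rectDiag m n σ)))
    {k l : ℕ} (hkm : k < m) (hln : l < n) (hkn : k < n) (hlm : l < m) (hkl : k ≠ l)
    (hne : σ k ^ 2 - σ l ^ 2 ≠ 0) :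
    L (Pi.single (⟨k, hkm⟩, ⟨l, hln⟩) 1) (⟨k, hkm⟩, ⟨l, hln⟩)
      = (σ k * scalarThreshold P (σ k) - σ l * scalarThreshold P (σ l))
        / (σ k ^ 2 - σ l ^ 2) := by
  have hl : ∀ d : ℕ → ℝ, pairsOfMatrix (planeGenerator (⟨k, hkm⟩ : Fin m) ⟨l, hlm⟩
        * rectDiag m n d)
      = d l • Pi.single ((⟨k, hkm⟩, ⟨l, hln⟩) : Fin m × Fin n) (1 : ℝ)
        - d k • Pi.single ((⟨l, hlm⟩, ⟨k, hkn⟩) : Fin m × Fin n) (1 : ℝ) := by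
    intro d
    funext ⟨i, j⟩
    simp only [pairsOfMatrix, planeGenerator_mul_apply, rectDiag_apply, Pi.sub_apply, Pi.smul_apply,
      smul_eq_mul, Pi.single_apply, Prod.mk.injEq, ite_and, mul_ite, mul_one, mul_zero, Fin.ext_iff,
      eq_comm (a := k), eq_comm (a := l)]
  have hr : ∀ d : ℕ → ℝ, pairsOfMatrix (rectDiag m n d
        * planeGenerator (⟨k, hkn⟩ : Fin n) ⟨l, hln⟩)
      = d k • Pi.single ((⟨k, hkm⟩, ⟨l, hln⟩) : Fin m × Fin n) (1 : ℝ)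
        - d l • Pi.single ((⟨l, hlm⟩, ⟨k, hkn⟩) : Fin m × Fin n) (1 : ℝ) := by
    intro d
    funext ⟨i, j⟩
    simp only [pairsOfMatrix, mul_planeGenerator_apply, rectDiag_apply, Pi.sub_apply, Pi.smul_apply,
      smul_eq_mul, Pi.single_apply, Prod.mk.injEq, mul_ite, mul_one, mul_zero, Fin.ext_iff,
      and_comm (a := (i : ℕ) = _), ite_and]
    congr 1 <;> refine if_congr Iff.rfl (ite_congr rfl (fun h => by rw [h]) fun _ => rfl) rfl
  have e1 := thresholdPairs_fderiv_rotation_left hc hP_cont hconv hP_zero hL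
    (k := ⟨k, hkm⟩) (l := ⟨l, hlm⟩) (by simpa using hkl)
  have e2 := thresholdPairs_fderiv_rotation_right hc hP_cont hconv hP_zero hL
    (k := ⟨k, hkn⟩) (l := ⟨l, hln⟩) (by simpa using hkl)
  rw [spectralThreshold_rectDiag hc hP_cont hconv hP_zero hσ hσ0] at e1 e2
  rw [hl, hl] at e1
  rw [hr, hr] at e2
  have f1 := congrFun e1 (⟨k, hkm⟩, ⟨l, hln⟩)
  have f2 := congrFun e2 (⟨k, hkm⟩, ⟨l, hln⟩)
  simp only [map_sub, map_smul, Pi.sub_apply, Pi.smul_apply, smul_eq_mul, Pi.single_apply,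
    Prod.mk.injEq, Fin.mk.injEq, and_self, if_true, hkl, hkl.symm, if_false, mul_one, mul_zero,
    sub_zero] at f1 f2
  rw [eq_div_iff hne]
  linear_combination σ k * f2 - σ l * f1

end Derivative

end Divergence

/-! ### Assembling the divergence. -/

section DivergenceFormula

open Matrix

variable {m n : ℕ} {P : ℝ → ℝ} {c : ℝ} (hc : 0 < c) (hP_cont : ContinuousOn P (Set.Ici 0))
    (hconv : ConvexOn ℝ (Set.Ici 0) (fun a => P a + (1 - c) / 2 * a ^ 2))
    (hP_zero : ∀ a : ℝ, 0 ≤ a → P 0 ≤ 1 / 2 * a ^ 2 + P a)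
    {L : (Fin m × Fin n → ℝ) →L[ℝ] (Fin m × Fin n → ℝ)}

section

include hc hP_cont hconv hP_zero

/-- A column index beyond the last row has no mirror entry, so the right rotation moves only the
entry `(k, l)` and one equation suffices. -/
lemma fderiv_thresholdPairs_wide {σ : ℕ → ℝ} (hσ : Antitone σ) (hσ0 : ∀ k, 0 ≤ σ k)
    (hL : HasFDerivAt (thresholdPairs P) L (pairsOfMatrix (rectDiag m n σ)))
    {k l : ℕ} (hkm : k < m) (hln : l < n) (hkn : k < n) (hml : m ≤ l) (hne : σ k ≠ 0) :
    L (Pi.single (⟨k, hkm⟩, ⟨l, hln⟩) 1) (⟨k, hkm⟩, ⟨l, hln⟩)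
      = scalarThreshold P (σ k) / σ k := by
  have hr : ∀ d : ℕ → ℝ, pairsOfMatrix (rectDiag m n d
        * planeGenerator (⟨k, hkn⟩ : Fin n) ⟨l, hln⟩)
      = d k • Pi.single ((⟨k, hkm⟩, ⟨l, hln⟩) : Fin m × Fin n) (1 : ℝ) := by
    intro d
    funext ⟨i, j⟩
    have hil : (i : ℕ) ≠ l := fun h => absurd i.2 (by omega)
    simp only [pairsOfMatrix, mul_planeGenerator_apply, rectDiag_apply, Pi.smul_apply,
      smul_eq_mul, Pi.single_apply, Prod.mk.injEq, mul_ite, mul_one, mul_zero, Fin.ext_iff, hil,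
      if_false, ite_self, sub_zero, and_comm (a := (i : ℕ) = _), ite_and]
    exact if_congr Iff.rfl (ite_congr rfl (fun h => by rw [h]) fun _ => rfl) rfl
  have e := thresholdPairs_fderiv_rotation_right hc hP_cont hconv hP_zero hL
    (k := ⟨k, hkn⟩) (l := ⟨l, hln⟩) (by simp only [ne_eq, Fin.mk.injEq]; omega)
  rw [spectralThreshold_rectDiag hc hP_cont hconv hP_zero hσ hσ0, hr, hr] at e
  have f := congrFun e (⟨k, hkm⟩, ⟨l, hln⟩)
  simp only [map_smul, Pi.smul_apply, smul_eq_mul, Pi.single_eq_same, mul_one] at f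
  rw [eq_div_iff hne, mul_comm]
  exact f

lemma fderiv_thresholdPairs_tall {σ : ℕ → ℝ} (hσ : Antitone σ) (hσ0 : ∀ k, 0 ≤ σ k)
    (hL : HasFDerivAt (thresholdPairs P) L (pairsOfMatrix (rectDiag m n σ)))
    {k l : ℕ} (hkm : k < m) (hln : l < n) (hlm : l < m) (hnk : n ≤ k) (hne : σ l ≠ 0) :
    L (Pi.single (⟨k, hkm⟩, ⟨l, hln⟩) 1) (⟨k, hkm⟩, ⟨l, hln⟩)
      = scalarThreshold P (σ l) / σ l := by
  have hr : ∀ d : ℕ → ℝ, pairsOfMatrix (planeGenerator (⟨k, hkm⟩ : Fin m) ⟨l, hlm⟩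
        * rectDiag m n d)
      = d l • Pi.single ((⟨k, hkm⟩, ⟨l, hln⟩) : Fin m × Fin n) (1 : ℝ) := by
    intro d
    funext ⟨i, j⟩
    have hjk : k ≠ (j : ℕ) := fun h => absurd j.2 (by omega)
    simp only [pairsOfMatrix, planeGenerator_mul_apply, rectDiag_apply, Pi.smul_apply,
      smul_eq_mul, Pi.single_apply, Prod.mk.injEq, mul_ite, mul_one, mul_zero, Fin.ext_iff, hjk,
      if_false, ite_self, sub_zero, ite_and, eq_comm (a := l)]
  have e := thresholdPairs_fderiv_rotation_left hc hP_cont hconv hP_zero hL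
    (k := ⟨k, hkm⟩) (l := ⟨l, hlm⟩) (by simp only [ne_eq, Fin.mk.injEq]; omega)
  rw [spectralThreshold_rectDiag hc hP_cont hconv hP_zero hσ hσ0, hr, hr] at e
  have f := congrFun e (⟨k, hkm⟩, ⟨l, hln⟩)
  simp only [map_smul, Pi.smul_apply, smul_eq_mul, Pi.single_eq_same, mul_one] at f
  rw [eq_div_iff hne, mul_comm]
  exact f

end

/-- As a trace, the divergence is invariant under conjugation, which permits the reduction to a
diagonal matrix. -/
lemma sum_apply_single_eq_trace {ι : Type*} [Fintype ι] [DecidableEq ι]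
    (L : (ι → ℝ) →ₗ[ℝ] (ι → ℝ)) : ∑ p, L (Pi.single p 1) p = LinearMap.trace ℝ _ L := by
  rw [LinearMap.trace_eq_matrix_trace ℝ (Pi.basisFun ℝ ι), Matrix.trace]
  refine Finset.sum_congr rfl fun p _ => ?_
  simp

/-- Conjugation of matrices by a pair of orthogonal matrices. -/
def conjPairs {U : Matrix (Fin m) (Fin m) ℝ} {V : Matrix (Fin n) (Fin n) ℝ}
    (hU : Uᵀ * U = 1) (hV : Vᵀ * V = 1) : (Fin m × Fin n → ℝ) ≃ₗ[ℝ] (Fin m × Fin n → ℝ) where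
  toFun z := pairsOfMatrix (U * matrixOfPairs z * Vᵀ)
  invFun z := pairsOfMatrix (Uᵀ * matrixOfPairs z * V)
  map_add' z w := by
    have : matrixOfPairs (z + w) = matrixOfPairs z + matrixOfPairs w := rfl
    rw [this, Matrix.mul_add, Matrix.add_mul]
    rfl
  map_smul' a z := by
    have : matrixOfPairs (a • z) = a • matrixOfPairs z := rfl
    rw [this, Matrix.mul_smul, Matrix.smul_mul]
    rfl
  left_inv z := by
    have : Uᵀ * (U * matrixOfPairs z * Vᵀ) * V = (Uᵀ * U) * matrixOfPairs z * (Vᵀ * V) := by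
      simp only [Matrix.mul_assoc]
    beta_reduce
    rw [matrixOfPairs_pairsOfMatrix, this, hU, hV, Matrix.one_mul, Matrix.mul_one,
      pairsOfMatrix_matrixOfPairs]
  right_inv z := by
    have : U * (Uᵀ * matrixOfPairs z * V) * Vᵀ = (U * Uᵀ) * matrixOfPairs z * (V * Vᵀ) := by
      simp only [Matrix.mul_assoc]
    beta_reduce
    rw [matrixOfPairs_pairsOfMatrix, this, mul_eq_one_comm.mp hU, mul_eq_one_comm.mp hV,
      Matrix.one_mul, Matrix.mul_one, pairsOfMatrix_matrixOfPairs]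

/-- Summation of the diagonal entries of the derivative of spectral thresholding. -/
lemma sum_divergence_entries (σ s s' : ℕ → ℝ) {a b : ℕ} (hab : a ≤ b) (g : ℕ → ℕ → ℝ)
    (hdiag : ∀ k < a, g k k = s' k)
    (hoff : ∀ k < a, ∀ l < a, k ≠ l →
      g k l = (σ k * s k - σ l * s l) / (σ k ^ 2 - σ l ^ 2))
    (hrect : ∀ k < a, ∀ l < b, a ≤ l → g k l = s k / σ k) :
    ∑ k ∈ Finset.range a, ∑ l ∈ Finset.range b, g k l
      = ∑ k ∈ Finset.range a, (s' k + ((b : ℝ) - a) * (s k / σ k))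
        + 2 * ∑ k ∈ Finset.range a, ∑ l ∈ (Finset.range a).erase k,
          σ k * s k / (σ k ^ 2 - σ l ^ 2) := by
  set G : ℕ → ℕ → ℝ := fun k l => σ k * s k / (σ k ^ 2 - σ l ^ 2) with hG
  -- Division by zero gives zero on the diagonal, so sums may run over all `l`. An off-diagonal
  -- entry is `G k l + G l k`, and exchanging the summation order yields the factor `2`.
  have hGd : ∀ k, G k k = 0 := fun k => by simp [hG]
  have herase : ∀ k ∈ Finset.range a, ∀ f : ℕ → ℝ, ∑ l ∈ (Finset.range a).erase k, f l
      = ∑ l ∈ Finset.range a, f l - f k := fun k hk f => by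
    rw [← Finset.add_sum_erase _ _ hk]
    ring
  have hrow : ∀ k ∈ Finset.range a, ∑ l ∈ Finset.range b, g k l
      = (s' k + ((b : ℝ) - a) * (s k / σ k)) + (∑ l ∈ Finset.range a, G k l
        + ∑ l ∈ Finset.range a, G l k) := by
    intro k hk
    have hka := Finset.mem_range.mp hk
    have h1 : ∑ l ∈ Finset.range a, g k l
        = s' k + (∑ l ∈ Finset.range a, G k l + ∑ l ∈ Finset.range a, G l k) := by
      rw [← Finset.add_sum_erase _ _ hk, hdiag k hka, ← Finset.sum_add_distrib]
      congr 1
      rw [← Finset.add_sum_erase _ (fun l => G k l + G l k) hk]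
      simp only [hGd, add_zero, zero_add]
      refine Finset.sum_congr rfl fun l hl => ?_
      have hl' := Finset.mem_erase.mp hl
      rw [hoff k hka l (Finset.mem_range.mp hl'.2) hl'.1.symm]
      simp only [hG]
      rw [← neg_sub (σ k ^ 2) (σ l ^ 2), div_neg, sub_div, sub_eq_add_neg]
    have h2 : ∑ l ∈ Finset.Ico a b, g k l = ((b : ℝ) - a) * (s k / σ k) := by
      rw [Finset.sum_congr rfl fun l hl => hrect k hka l (Finset.mem_Ico.mp hl).2
        (Finset.mem_Ico.mp hl).1]
      simp [Nat.cast_sub hab]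
    rw [← Finset.sum_range_add_sum_Ico _ hab, h1, h2]
    ring
  rw [Finset.sum_congr rfl hrow, Finset.sum_add_distrib,
    Finset.sum_add_distrib (f := fun k => ∑ l ∈ Finset.range a, G k l),
    Finset.sum_comm (f := fun k l => G l k), ← two_mul]
  congr 2
  refine Finset.sum_congr rfl fun k hk => ?_
  rw [herase k hk (G k), hGd, sub_zero]

include hc hP_cont hconv hP_zero

/-- The divergence of spectral thresholding at a rectangular diagonal matrix. -/
lemma divergence_thresholdPairs_rectDiag {σ : ℕ → ℝ} (hσ : Antitone σ) (hσ0 : ∀ k, 0 ≤ σ k)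
    (hpos : ∀ k < min m n, 0 < σ k) (hlt : ∀ k < min m n, σ (k + 1) < σ k)
    (hL : HasFDerivAt (thresholdPairs P) L (pairsOfMatrix (rectDiag m n σ))) :
    (∀ k < min m n, DifferentiableAt ℝ (scalarThreshold P) (σ k)) ∧
    ∑ p, L (Pi.single p 1) p
      = ∑ k ∈ Finset.range (min m n), (deriv (scalarThreshold P) (σ k)
          + |(m : ℝ) - n| * (scalarThreshold P (σ k) / σ k))
        + 2 * ∑ k ∈ Finset.range (min m n), ∑ l ∈ (Finset.range (min m n)).erase k,
          σ k * scalarThreshold P (σ k) / (σ k ^ 2 - σ l ^ 2) := by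
  have hstrict : ∀ k l, k < l → l < min m n → σ l < σ k := fun k l hkl hl =>
    (hσ (Nat.succ_le_of_lt hkl)).trans_lt (hlt k (hkl.trans hl))
  have hsq : ∀ k < min m n, ∀ l < min m n, k ≠ l → σ k ^ 2 - σ l ^ 2 ≠ 0 := by
    intro k hk l hl hkl h
    have h1 : σ k = σ l := (sq_eq_sq₀ (hσ0 k) (hσ0 l)).mp (sub_eq_zero.mp h)
    rcases lt_or_gt_of_ne hkl with h2 | h2
    · exact absurd h1 (hstrict k l h2 hl).ne'
    · exact absurd h1 (hstrict l k h2 hk).ne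
  have hder : ∀ k (hkm : k < m) (hkn : k < n), HasDerivAt (scalarThreshold P)
      (L (Pi.single (⟨k, hkm⟩, ⟨k, hkn⟩) 1) (⟨k, hkm⟩, ⟨k, hkn⟩)) (σ k) := fun k hkm hkn =>
    hasDerivAt_scalarThreshold hc hP_cont hconv hP_zero hσ hσ0 hL hkm hkn
      (hlt k (lt_min hkm hkn)) fun j hj => hstrict j k hj (lt_min hkm hkn)
  refine ⟨fun k hk => (hder k (lt_min_iff.mp hk).1 (lt_min_iff.mp hk).2).differentiableAt, ?_⟩
  set g : ℕ → ℕ → ℝ := fun k l => if h : k < m ∧ l < n then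
    L (Pi.single (⟨k, h.1⟩, ⟨l, h.2⟩) 1) (⟨k, h.1⟩, ⟨l, h.2⟩) else 0 with hg
  have hsum : ∑ p, L (Pi.single p 1) p = ∑ k ∈ Finset.range m, ∑ l ∈ Finset.range n, g k l := by
    rw [Fintype.sum_prod_type, Finset.sum_range]
    refine Finset.sum_congr rfl fun i _ => ?_
    rw [Finset.sum_range]
    exact Finset.sum_congr rfl fun j _ => by simp [hg]
  have hgd : ∀ k < min m n, g k k = deriv (scalarThreshold P) (σ k) := by
    intro k hk
    have hk' := lt_min_iff.mp hk
    simp only [hg, dif_pos hk']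
    exact (hder k hk'.1 hk'.2).deriv.symm
  have hgo : ∀ k < min m n, ∀ l < min m n, k ≠ l → g k l
      = (σ k * scalarThreshold P (σ k) - σ l * scalarThreshold P (σ l))
        / (σ k ^ 2 - σ l ^ 2) := by
    intro k hk l hl hkl
    have hk' := lt_min_iff.mp hk
    have hl' := lt_min_iff.mp hl
    simp only [hg, dif_pos (And.intro hk'.1 hl'.2)]
    exact fderiv_thresholdPairs_square hc hP_cont hconv hP_zero hσ hσ0 hL hk'.1 hl'.2 hk'.2 hl'.1
      hkl (hsq k hk l hl hkl)
  rw [hsum]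
  rcases le_total m n with hmn | hmn
  · rw [min_eq_left hmn] at hgd hgo hpos ⊢
    rw [sum_divergence_entries σ (fun k => scalarThreshold P (σ k))
      (fun k => deriv (scalarThreshold P) (σ k)) hmn g hgd hgo]
    · rw [abs_sub_comm, abs_of_nonneg (sub_nonneg.mpr (by exact_mod_cast hmn))]
    · intro k hk l hl hml
      simp only [hg, dif_pos (And.intro hk hl)]
      exact fderiv_thresholdPairs_wide hc hP_cont hconv hP_zero hσ hσ0 hL hk hl (hk.trans_le hmn)
        hml (hpos k hk).ne'
  · rw [min_eq_right hmn] at hgd hgo hpos ⊢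
    rw [Finset.sum_comm, sum_divergence_entries σ (fun k => scalarThreshold P (σ k))
      (fun k => deriv (scalarThreshold P) (σ k)) hmn (fun k l => g l k) hgd]
    · rw [abs_of_nonneg (sub_nonneg.mpr (by exact_mod_cast hmn))]
    · intro k hk l hl hkl
      rw [hgo l hl k hk hkl.symm, ← neg_div_neg_eq, neg_sub, neg_sub]
    · intro k hk l hl hml
      simp only [hg, dif_pos (And.intro hl hk)]
      exact fderiv_thresholdPairs_tall hc hP_cont hconv hP_zero hσ hσ0 hL hl hk (hk.trans_le hmn)
        hml (hpos k hk).ne'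

/-- The divergence of spectral thresholding at a point of differentiability with positive and
pairwise distinct singular values. -/
theorem divergence_thresholdPairs {z : Fin m × Fin n → ℝ}
    (hz : ∀ i < min m n, 0 < singVal (matrixOfPairs z) i ∧
      ∀ j < min m n, i ≠ j → singVal (matrixOfPairs z) i ≠ singVal (matrixOfPairs z) j)
    (hL : HasFDerivAt (thresholdPairs P) L z) :
    (∀ k < min m n, DifferentiableAt ℝ (scalarThreshold P) (singVal (matrixOfPairs z) k)) ∧
    ∑ p, L (Pi.single p 1) p = dfExpression (scalarThreshold P) (matrixOfPairs z) := by
  obtain ⟨U, V, hU, hV, h⟩ := exists_svd (matrixOfPairs z)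
  set σ := singVal (matrixOfPairs z) with hσ
  have hanti : Antitone σ := singVal_antitone _
  have hlt : ∀ k < min m n, σ (k + 1) < σ k := by
    intro k hk
    refine lt_of_le_of_ne (hanti k.le_succ) ?_
    -- At the last index the next singular value is `0` by convention, and strict decrease is
    -- positivity.
    by_cases hk1 : k + 1 < min m n
    · exact (hz (k + 1) hk1).2 k hk (Nat.succ_ne_self k)
    · rw [hσ, singVal_eq_zero_of_le _ (not_lt.mp hk1)]
      exact (hz k hk).1.ne
  set Φ := conjPairs hU hV with hΦ
  set Ψ := Φ.toContinuousLinearEquiv with hΨ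
  have hΨz : Ψ (pairsOfMatrix (rectDiag m n σ)) = z := by
    change pairsOfMatrix (U * rectDiag m n σ * Vᵀ) = z
    rw [← h, pairsOfMatrix_matrixOfPairs]
  have hcomm : ∀ w, thresholdPairs P (Ψ w) = Ψ (thresholdPairs P w) := by
    intro w
    change pairsOfMatrix (spectralThreshold P (U * matrixOfPairs w * Vᵀ))
      = pairsOfMatrix (U * spectralThreshold P (matrixOfPairs w) * Vᵀ)
    rw [spectralThreshold_conj hc hP_cont hconv hP_zero hU hV]
  have hL1 : HasFDerivAt (thresholdPairs P)
      ((Ψ.symm : (Fin m × Fin n → ℝ) →L[ℝ] _).comp (L.comp (Ψ : (Fin m × Fin n → ℝ) →L[ℝ] _)))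
      (pairsOfMatrix (rectDiag m n σ)) := by
    have h1 : HasFDerivAt (Ψ.symm ∘ thresholdPairs P ∘ Ψ)
        ((Ψ.symm : (Fin m × Fin n → ℝ) →L[ℝ] _).comp (L.comp (Ψ : (Fin m × Fin n → ℝ) →L[ℝ] _)))
        (pairsOfMatrix (rectDiag m n σ)) :=
      Ψ.symm.hasFDerivAt.comp _ ((hΨz.symm ▸ hL).comp _ Ψ.hasFDerivAt)
    have h2 : Ψ.symm ∘ thresholdPairs P ∘ Ψ = thresholdPairs P := by
      funext w
      simp only [Function.comp_apply, hcomm, ContinuousLinearEquiv.symm_apply_apply]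
    rwa [h2] at h1
  have hmain := divergence_thresholdPairs_rectDiag hc hP_cont hconv hP_zero hanti
    (singVal_nonneg _) (fun k hk => (hz k hk).1) hlt hL1
  refine ⟨hmain.1, ?_⟩
  have htr : ∑ p, L (Pi.single p 1) p 
      = ∑ p, ((Ψ.symm : (Fin m × Fin n → ℝ) →L[ℝ] (Fin m × Fin n → ℝ)).comp
        (L.comp (Ψ : (Fin m × Fin n → ℝ) →L[ℝ] (Fin m × Fin n → ℝ)))) (Pi.single p 1) p := by
    have h1 := sum_apply_single_eq_trace (L : (Fin m × Fin n → ℝ) →ₗ[ℝ] _)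
    have h2 := sum_apply_single_eq_trace (Φ.symm.conj (L : (Fin m × Fin n → ℝ) →ₗ[ℝ] _))
    rw [LinearMap.trace_conj'] at h2
    exact h1.trans h2.symm
  rw [htr, hmain.2]
  rfl

end DivergenceFormula

/-! ### Stein's identity for Lipschitz functions. -/

section Stein

open Filter

lemma hasDerivAt_gaussianPDFReal (μ : ℝ) {w : ℝ≥0} (hw : w ≠ 0) (t : ℝ) :
    HasDerivAt (gaussianPDFReal μ w) (-((t - μ) / w) * gaussianPDFReal μ w t) t := by
  have hw' : (w : ℝ) ≠ 0 := by exact_mod_cast hw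
  have h1 : HasDerivAt (fun x : ℝ => -(x - μ) ^ 2 / (2 * w)) (-((t - μ) / w)) t := by
    have h := ((((hasDerivAt_id t).sub_const μ).pow 2).neg).div_const (2 * (w : ℝ))
    refine h.congr_deriv ?_
    simp only [id]
    field_simp
    simp
    ring
  rw [gaussianPDFReal_def]
  refine (h1.exp.const_mul _).congr_deriv ?_
  ring

lemma integrable_gaussianReal_iff {μ : ℝ} {w : ℝ≥0} (hw : w ≠ 0) {f : ℝ → ℝ} :
    Integrable f (gaussianReal μ w) ↔ Integrable (fun t => gaussianPDFReal μ w t * f t) := by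
  rw [gaussianReal_of_var_ne_zero _ hw, integrable_withDensity_iff_integrable_smul'
    (measurable_gaussianPDF _ _) (ae_of_all _ fun _ => gaussianPDF_lt_top)]
  simp only [toReal_gaussianPDF, smul_eq_mul]

lemma LipschitzWith.memLp_of_memLp_id {E : Type*} [NormedAddCommGroup E] [MeasurableSpace E]
    {Γ : Measure E} [IsFiniteMeasure Γ] {p : ℝ≥0∞} (hid : MemLp (fun z : E => z) p Γ) {K : ℝ≥0}
    {f : E → ℝ} (hf : LipschitzWith K f) : MemLp f p Γ := by
  have h1 : LipschitzWith K (fun z => f z - f 0) := by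
    simpa using hf.sub (LipschitzWith.const (f 0))
  have h2 : MemLp ((fun z => f z - f 0) ∘ fun z : E => z) p Γ := h1.comp_memLp (by simp) hid
  have h3 := h2.add (memLp_const (f 0))
  refine h3.ae_eq (Eventually.of_forall fun z => ?_)
  simp

/-- **Stein's identity** for a Lipschitz function of a real Gaussian variable. -/
theorem integral_mul_sub_gaussianReal (μ : ℝ) {w : ℝ≥0} (hw : w ≠ 0) {K : ℝ≥0} {f : ℝ → ℝ}
    (hf : LipschitzWith K f) :
    ∫ t, (f t * (t - μ) - w * deriv f t) ∂(gaussianReal μ w) = 0 := by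
  have hw' : (w : ℝ) ≠ 0 := by exact_mod_cast hw
  set φ := gaussianPDFReal μ w with hφ
  have hφd : ∀ t, HasDerivAt φ (-((t - μ) / w) * φ t) t := hasDerivAt_gaussianPDFReal μ hw
  have hid : MemLp (fun t : ℝ => t) 2 (gaussianReal μ w) := memLp_id_gaussianReal' 2 (by simp)
  have hf2 : MemLp f 2 (gaussianReal μ w) := hf.memLp_of_memLp_id hid
  have hi1 : Integrable (fun t => φ t * f t) :=
    (integrable_gaussianReal_iff hw).mp (hf2.integrable one_le_two)
  have hi2 : Integrable (fun t => φ t * (f t * (t - μ))) :=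
    (integrable_gaussianReal_iff hw).mp (hf2.integrable_mul (hid.sub (memLp_const μ)))
  have hi3 : Integrable (fun t => φ t * deriv f t) := by
    refine (integrable_gaussianReal_iff hw).mp ?_
    exact Integrable.of_bound (measurable_deriv f).aestronglyMeasurable (K : ℝ)
      (Eventually.of_forall fun t => norm_deriv_le_of_lipschitz hf)
  have hint : Integrable (fun t => deriv f t * φ t + f t * deriv φ t) := by
    refine (hi3.sub (hi2.div_const w)).congr (Eventually.of_forall fun t => ?_)
    simp only [Pi.sub_apply, (hφd t).deriv]
    ring
  have hparts : ∀ R : ℝ, ∫ t in (-R)..R, (deriv f t * φ t + f t * deriv φ t)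
      = f R * φ R - f (-R) * φ (-R) := by
    intro R
    refine AbsolutelyContinuousOnInterval.integral_deriv_mul_eq_sub
      (hf.lipschitzOnWith.absolutelyContinuousOnInterval)
      (ContDiffOn.absolutelyContinuousOnInterval (ContDiff.contDiffOn ?_))
    rw [hφ, gaussianPDFReal_def]
    fun_prop
  have hlim := intervalIntegral_tendsto_integral hint tendsto_neg_atTop_atBot tendsto_id
  simp only [id, hparts] at hlim
  -- The boundary terms converge as `R` grows, and they are integrable in `R`, so their limit can
  -- only be `0`.
  have hbd : Integrable (fun R => f R * φ R - f (-R) * φ (-R)) := by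
    have : Integrable (fun R => f R * φ R) := by simpa only [mul_comm] using hi1
    exact this.sub this.comp_neg
  have hzero := (hbd.integrableAtFilter atTop).eq_zero_of_tendsto (fun s hs => by
    obtain ⟨a, ha⟩ := mem_atTop_sets.mp hs
    exact top_unique (by
      rw [← Real.volume_Ici (a := a)]
      exact measure_mono ha)) hlim
  rw [integral_gaussianReal_eq_integral_smul hw]
  have heq : (fun t => φ t • (f t * (t - μ) - w * deriv f t))
      = fun t => (-(w : ℝ)) * (deriv f t * φ t + f t * deriv φ t) := by
    funext t
    simp only [(hφd t).deriv, smul_eq_mul]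
    field_simp
    ring
  rw [heq, integral_const_mul, hzero, mul_zero]

variable {ι : Type*} [Fintype ι] [DecidableEq ι]

/-- Resampling one coordinate preserves a product probability measure. -/
lemma measurePreserving_update {α : ι → Type*} [∀ i, MeasurableSpace (α i)]
    (γ : ∀ i, Measure (α i)) [∀ i, IsProbabilityMeasure (γ i)] (p : ι) :
    MeasurePreserving (fun x : (∀ i, α i) × α p => Function.update x.1 p x.2)
      ((Measure.pi γ).prod (γ p)) (Measure.pi γ) := by
  have hmeas : Measurable (fun x : (∀ i, α i) × α p => Function.update x.1 p x.2) :=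
    measurable_pi_iff.mpr fun i => by
      rcases eq_or_ne i p with rfl | hi
      · simpa using measurable_snd
      · simpa [hi, Function.comp_def] using (measurable_pi_apply i).comp measurable_fst
  refine ⟨hmeas, (Measure.pi_eq fun s hs => ?_).symm⟩
  rw [Measure.map_apply hmeas (MeasurableSet.univ_pi hs)]
  have hpre : (fun x : (∀ i, α i) × α p => Function.update x.1 p x.2) ⁻¹' (Set.univ.pi s)
      = (Set.univ.pi (Function.update s p Set.univ)) ×ˢ s p := by
    ext ⟨z, t⟩
    simp only [Set.mem_preimage, Set.mem_univ_pi, Set.mem_prod]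
    constructor
    · intro h
      refine ⟨fun i => ?_, by simpa using h p⟩
      rcases eq_or_ne i p with rfl | hi
      · simp
      · simpa [hi] using h i
    · rintro ⟨h1, h2⟩ i
      rcases eq_or_ne i p with rfl | hi
      · simpa using h2
      · simpa [hi] using h1 i
  rw [hpre, Measure.prod_prod, Measure.pi_pi, ← Finset.mul_prod_erase _ _ (Finset.mem_univ p),
    ← Finset.mul_prod_erase _ (fun i => γ i (s i)) (Finset.mem_univ p)]
  have : ∏ x ∈ Finset.univ.erase p, γ x (Function.update s p Set.univ x)
      = ∏ x ∈ Finset.univ.erase p, γ x (s x) :=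
    Finset.prod_congr rfl fun i hi => by rw [Function.update_of_ne (Finset.ne_of_mem_erase hi)]
  rw [this, Function.update_self, measure_univ, one_mul, mul_comm]

omit [DecidableEq ι] in
lemma memLp_id_pi_gaussianReal (μ : ι → ℝ) (w : ℝ≥0) :
    MemLp (fun z : ι → ℝ => z) 2 (Measure.pi fun i => gaussianReal (μ i) w) :=
  MemLp.of_eval fun i =>
    (memLp_id_gaussianReal' (μ := μ i) (v := w) 2 (by simp)).comp_measurePreserving
      (measurePreserving_eval (fun i => gaussianReal (μ i) w) i)

/-- Line derivatives are total functions bounded by `K * ‖e‖`, so integrability does not wait for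
Fréchet differentiability. -/
lemma LipschitzWith.integrable_lineDeriv {E : Type*} [NormedAddCommGroup E] [NormedSpace ℝ E]
    [FiniteDimensional ℝ E]
    [MeasurableSpace E] [BorelSpace E] {Γ : Measure E} [IsFiniteMeasure Γ] {K : ℝ≥0} {f : E → ℝ}
    (hf : LipschitzWith K f) (e : E) : Integrable (fun z => lineDeriv ℝ f z e) Γ :=
  Integrable.of_bound (measurable_lineDeriv hf.continuous).aestronglyMeasurable (K * ‖e‖)
    (Eventually.of_forall fun _ => norm_lineDeriv_le_of_lipschitz ℝ hf)

/-- **Stein's identity** for a Lipschitz function of independent Gaussian variables. -/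
theorem integral_mul_sub_pi_gaussianReal (μ : ι → ℝ) {w : ℝ≥0} (hw : w ≠ 0) {K : ℝ≥0}
    {f : (ι → ℝ) → ℝ} (hf : LipschitzWith K f) (p : ι) :
    ∫ z, f z * (z p - μ p) ∂(Measure.pi fun i => gaussianReal (μ i) w)
      = w * ∫ z, lineDeriv ℝ f z (Pi.single p 1) ∂(Measure.pi fun i => gaussianReal (μ i) w) := by
  set Γ := Measure.pi fun i => gaussianReal (μ i) w with hΓ
  have hid := memLp_id_pi_gaussianReal μ w
  have hf2 : MemLp f 2 Γ := hf.memLp_of_memLp_id hid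
  have hi1 : Integrable (fun z => f z * (z p - μ p)) Γ :=
    hf2.integrable_mul ((hid.eval p).sub (memLp_const (μ p)))
  have hi2 : Integrable (fun z => w * lineDeriv ℝ f z (Pi.single p 1)) Γ :=
    (hf.integrable_lineDeriv _).const_mul _
  rw [← integral_const_mul, ← sub_eq_zero, ← integral_sub hi1 hi2]
  have hi := hi1.sub hi2
  -- Resampling coordinate `p` and applying Fubini freezes the other coordinates; the inner integral
  -- vanishes by the one-dimensional identity.
  have hmp := measurePreserving_update (fun i => gaussianReal (μ i) w) p
  rw [← hΓ] at hmp
  rw [← hmp.map_eq, integral_map hmp.aemeasurable (by rw [hmp.map_eq]; exact hi.1)]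
  refine (integral_prod _ (hmp.integrable_comp_of_integrable hi)).trans ?_
  refine integral_eq_zero_of_ae (Eventually.of_forall fun z => ?_)
  have hlip : LipschitzWith K (fun t => f (Function.update z p t)) := by
    refine LipschitzWith.of_dist_le_mul fun s t => (hf.dist_le_mul _ _).trans
      (mul_le_mul_of_nonneg_left ((dist_pi_le_iff dist_nonneg).mpr fun i => ?_) K.coe_nonneg)
    rcases eq_or_ne i p with rfl | hi
    · simp
    · simp [hi]
  have hder : ∀ t, lineDeriv ℝ f (Function.update z p t) (Pi.single p 1)
      = deriv (fun t => f (Function.update z p t)) t := by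
    intro t
    have h1 : ∀ s : ℝ, Function.update z p t + s • Pi.single p (1 : ℝ)
        = Function.update z p (t + s) := by
      intro s
      funext i
      rcases eq_or_ne i p with rfl | hi
      · simp
      · simp [hi]
    simp only [lineDeriv, h1]
    rw [deriv_comp_const_add (fun t => f (Function.update z p t)) t, add_zero]
  simp only [Function.comp_apply, Pi.sub_apply, Function.update_self, hder]
  exact integral_mul_sub_gaussianReal (μ p) hw hlip

omit [DecidableEq ι] in
-- Transfers Lebesgue almost-everywhere statements to the law of the data; the density is the
-- product of the Gaussian densities.
lemma pi_gaussianReal_absolutelyContinuous (μ : ι → ℝ) {w : ℝ≥0} (hw : w ≠ 0) :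
    (Measure.pi fun i => gaussianReal (μ i) w) ≪ volume := by
  have hint : ∀ s : ι → Set ℝ, (∀ i, MeasurableSet (s i)) → Integrable
      (fun z : ι → ℝ => ∏ i, (s i).indicator (gaussianPDFReal (μ i) w) (z i)) := fun s hs =>
    Integrable.fintype_prod fun i => (integrable_gaussianPDFReal (μ i) w).indicator (hs i)
  have h : (Measure.pi fun i => gaussianReal (μ i) w) = (volume : Measure (ι → ℝ)).withDensity
      (fun z => ENNReal.ofReal (∏ i, gaussianPDFReal (μ i) w (z i))) := by
    refine Measure.pi_eq fun s hs => ?_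
    have hind : ∀ z : ι → ℝ, (Set.univ.pi s).indicator
        (fun z => ENNReal.ofReal (∏ i, gaussianPDFReal (μ i) w (z i))) z
        = ENNReal.ofReal (∏ i, (s i).indicator (gaussianPDFReal (μ i) w) (z i)) := by
      intro z
      by_cases hz : z ∈ Set.univ.pi s
      · rw [Set.indicator_of_mem hz]
        congr 1
        exact Finset.prod_congr rfl fun i _ =>
          (Set.indicator_of_mem (hz i (Set.mem_univ i)) _).symm
      · rw [Set.indicator_of_notMem hz]
        obtain ⟨i, hi⟩ : ∃ i, z i ∉ s i := by simpa [Set.mem_univ_pi] using hz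
        rw [Finset.prod_eq_zero (Finset.mem_univ i) (Set.indicator_of_notMem hi _),
          ENNReal.ofReal_zero]
    have hnn : ∀ z : ι → ℝ, 0 ≤ ∏ i, (s i).indicator (gaussianPDFReal (μ i) w) (z i) := fun z =>
      Finset.prod_nonneg fun i _ => Set.indicator_nonneg (fun _ _ => gaussianPDFReal_nonneg _ _ _) _
    rw [withDensity_apply _ (MeasurableSet.univ_pi hs),
      ← lintegral_indicator (MeasurableSet.univ_pi hs), lintegral_congr hind,
      ← ofReal_integral_eq_lintegral_ofReal (hint s hs) (Eventually.of_forall hnn),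
      integral_fintype_prod_volume_eq_prod
        (fun i => (s i).indicator (gaussianPDFReal (μ i) w)),
      ENNReal.ofReal_prod_of_nonneg]
    · refine Finset.prod_congr rfl fun i _ => ?_
      rw [gaussianReal_apply_eq_integral _ hw, integral_indicator (hs i)]
    · exact fun i _ => integral_nonneg fun t =>
        Set.indicator_nonneg (fun _ _ => gaussianPDFReal_nonneg _ _ _) t
  rw [h]
  exact withDensity_absolutelyContinuous _ _

end Stein

/-! ### The Gaussian model and the degrees of freedom. -/

section GaussianModel

variable {m n : ℕ}

/-- The law of the entries of a matrix with independent Gaussian noise. -/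
lemma hasLaw_pairsOfMatrix {Ω : Type*} [MeasurableSpace Ω] {ρ : Measure Ω} [IsProbabilityMeasure ρ]
    {w : ℝ≥0} {M : Matrix (Fin m) (Fin n) ℝ} {ε : Fin m → Fin n → Ω → ℝ}
    (hε_law : ∀ i j, HasLaw (ε i j) (gaussianReal 0 w) ρ)
    (hε_indep : iIndepFun (fun p : Fin m × Fin n => ε p.1 p.2) ρ)
    {Z : Ω → Matrix (Fin m) (Fin n) ℝ} (hZ : ∀ ω i j, Z ω i j = M i j + ε i j ω) :
    HasLaw (fun ω => pairsOfMatrix (Z ω))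
      (Measure.pi fun p : Fin m × Fin n => gaussianReal (pairsOfMatrix M p) w) ρ := by
  have hlaw : ∀ p : Fin m × Fin n, HasLaw (fun ω => M p.1 p.2 + ε p.1 p.2 ω)
      (gaussianReal (pairsOfMatrix M p) w) ρ := by
    intro p
    have := gaussianReal_const_add (hε_law p.1 p.2) (M p.1 p.2)
    rwa [zero_add] at this
  have hind : iIndepFun (fun (p : Fin m × Fin n) ω => M p.1 p.2 + ε p.1 p.2 ω) ρ :=
    hε_indep.comp (fun p x => M p.1 p.2 + x) fun p => by fun_prop
  have hX : (fun ω => pairsOfMatrix (Z ω))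
      = fun ω (p : Fin m × Fin n) => M p.1 p.2 + ε p.1 p.2 ω := by
    funext ω p
    exact hZ ω p.1 p.2
  rw [hX]
  refine ⟨aemeasurable_pi_iff.mpr fun p => (hlaw p).aemeasurable, ?_⟩
  rw [(iIndepFun_iff_map_fun_eq_pi_map fun p => (hlaw p).aemeasurable).mp hind]
  congr 1
  funext p
  exact (hlaw p).map_eq

lemma covariance_pi_gaussianReal {ι : Type*} [Fintype ι] [DecidableEq ι] (μ : ι → ℝ) {w : ℝ≥0}
    (hw : w ≠ 0) {K : ℝ≥0} {f : (ι → ℝ) → ℝ} (hf : LipschitzWith K f) (p : ι) :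
    cov[f, fun z => z p; Measure.pi fun i => gaussianReal (μ i) w]
      = w * ∫ z, lineDeriv ℝ f z (Pi.single p 1)
        ∂(Measure.pi fun i => gaussianReal (μ i) w) := by
  have hid := memLp_id_pi_gaussianReal μ w
  have hf2 := hf.memLp_of_memLp_id hid
  rw [← integral_mul_sub_pi_gaussianReal μ hw hf p, covariance_eq_sub hf2 (hid.eval p)]
  set Γ := Measure.pi fun i => gaussianReal (μ i) w with hΓ
  have hmean : ∫ z, z p ∂Γ = μ p := by
    have hmp := measurePreserving_eval (fun i => gaussianReal (μ i) w) p
    rw [← hΓ] at hmp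
    have h1 : ∫ t, t ∂(gaussianReal (μ p) w) = ∫ z, z p ∂Γ := by
      rw [← hmp.map_eq, integral_map hmp.aemeasurable (by fun_prop)]
    rw [← h1, integral_id_gaussianReal]
  rw [hmean]
  simp only [mul_sub]
  have h1 : Integrable (fun z => f z * z p) Γ := hf2.integrable_mul (hid.eval p)
  rw [integral_sub h1 ((hf2.integrable one_le_two).mul_const _), integral_mul_const]
  rfl

end GaussianModel

theorem mainTheorem3
    {m n : ℕ}
    -- the penalty `P(·; λ, γ)` on `[0, ∞)`, for fixed `(λ, γ)`
    (P : ℝ → ℝ)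
    (hP_cont : ContinuousOn P (Set.Ici 0))
    (hP_diff : ∀ a : ℝ, 0 < a → DifferentiableAt ℝ P a)
    -- zero is thresholded to zero (automatic if `P` is nondecreasing)
    (hP_zero : ∀ a : ℝ, 0 ≤ a → P 0 ≤ 1 / 2 * a ^ 2 + P a)
    (hP_index : 0 < 1 + concavityIndex P)
    -- the additive Gaussian model `Z = M + ε`
    {Ω : Type*} [MeasurableSpace Ω] (ρ : Measure Ω) [IsProbabilityMeasure ρ]
    (v : ℝ≥0) (hv : 0 < v)
    (M : Matrix (Fin m) (Fin n) ℝ)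
    (ε : Fin m → Fin n → Ω → ℝ)
    (hε_law : ∀ i j, HasLaw (ε i j) (gaussianReal 0 (v ^ 2)) ρ)
    (hε_indep : iIndepFun (fun p : Fin m × Fin n => ε p.1 p.2) ρ)
    (Z : Ω → Matrix (Fin m) (Fin n) ℝ)
    (hZ : ∀ ω i j, Z ω i j = M i j + ε i j ω) :
    -- both thresholding operators are well defined
    (∀ A X : Matrix (Fin m) (Fin n) ℝ, IsSpectralMinimizer P A X ↔ X = spectralThreshold P A) ∧
    (∀ x : ℝ, 0 ≤ x → ∀ a : ℝ, IsScalarMinimizer P x a ↔ a = scalarThreshold P x) ∧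
    -- every derivative and quotient in the formula makes sense almost surely
    (∀ᵐ ω ∂ρ, ∀ i < min m n, 0 < singVal (Z ω) i ∧
      DifferentiableAt ℝ (scalarThreshold P) (singVal (Z ω) i) ∧
      ∀ j < min m n, i ≠ j → singVal (Z ω) i ≠ singVal (Z ω) j) ∧
    -- the covariances and the expectation exist
    (∀ i j, MemLp (fun ω => spectralThreshold P (Z ω) i j) 2 ρ) ∧
    Integrable (fun ω => dfExpression (scalarThreshold P) (Z ω)) ρ ∧
    degreesOfFreedom ρ (v : ℝ) (spectralThreshold P) Z
      = ∫ ω, dfExpression (scalarThreshold P) (Z ω) ∂ρ := by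
  obtain ⟨c, hc, hquot⟩ := exists_pos_le_of_concavityIndex hP_index
  have hconv := convexOn_penalty hP_cont hP_diff hquot
  have hw : v ^ 2 ≠ 0 := pow_ne_zero 2 hv.ne'
  have hX := hasLaw_pairsOfMatrix hε_law hε_indep hZ
  set X : Ω → Fin m × Fin n → ℝ := fun ω => pairsOfMatrix (Z ω) with hXdef
  set Γ := Measure.pi fun p : Fin m × Fin n => gaussianReal (pairsOfMatrix M p) (v ^ 2) with hΓ
  obtain ⟨K, hK⟩ := exists_lipschitzWith_thresholdPairs (m := m) (n := n) hc hP_cont hconv hP_zero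
  have hKp : ∀ p, LipschitzWith K (fun z : Fin m × Fin n → ℝ => thresholdPairs P z p) := fun p =>
    LipschitzWith.of_dist_le_mul fun z w => (dist_le_pi_dist _ _ p).trans (hK.dist_le_mul z w)
  -- Simplicity of the spectrum and Rademacher's theorem both hold Lebesgue almost everywhere, hence
  -- almost surely for the data.
  have hgood : ∀ᵐ ω ∂ρ, (∀ i < min m n, 0 < singVal (Z ω) i ∧
      ∀ j < min m n, i ≠ j → singVal (Z ω) i ≠ singVal (Z ω) j)
      ∧ DifferentiableAt ℝ (thresholdPairs P) (X ω) := by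
    have h1 := (pi_gaussianReal_absolutelyContinuous (pairsOfMatrix M) hw).ae_le
      (ae_singVal_pos_and_ne.and hK.ae_differentiableAt)
    rw [← hΓ, ← hX.map_eq] at h1
    exact ae_of_ae_map hX.aemeasurable h1
  -- At such points the divergence formula identifies the explicit expression with the sum of line
  -- derivatives in Stein's identity, from which its integrability also follows.
  have hdiv : ∀ᵐ ω ∂ρ, dfExpression (scalarThreshold P) (Z ω)
      = ∑ p, lineDeriv ℝ (fun z => thresholdPairs P z p) (X ω) (Pi.single p 1) := by
    filter_upwards [hgood] with ω hω
    have h1 := (divergence_thresholdPairs hc hP_cont hconv hP_zero (z := X ω) hω.1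
      hω.2.hasFDerivAt).2
    rw [hXdef] at h1 ⊢
    simp only [matrixOfPairs_pairsOfMatrix] at h1
    rw [← h1]
    refine Finset.sum_congr rfl fun p _ => ?_
    have h2 := (hasFDerivAt_pi'.mp hω.2.hasFDerivAt p).hasLineDerivAt (Pi.single p 1)
    exact h2.lineDeriv.symm
  have hline : ∀ p, Integrable
      (fun z => lineDeriv ℝ (fun z => thresholdPairs P z p) z (Pi.single p 1)) Γ :=
    fun p => (hKp p).integrable_lineDeriv _
  have hlineX : ∀ p, Integrable
      (fun ω => lineDeriv ℝ (fun z => thresholdPairs P z p) (X ω) (Pi.single p 1)) ρ := fun p =>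
    (hX.map_eq ▸ hline p).comp_aemeasurable hX.aemeasurable
  refine ⟨isSpectralMinimizer_iff hc hP_cont hconv hP_zero,
    fun x _ a => isScalarMinimizer_iff hc hP_cont hconv hP_zero x a, ?_, ?_, ?_, ?_⟩
  · filter_upwards [hgood] with ω hω i hi
    exact ⟨(hω.1 i hi).1, (divergence_thresholdPairs hc hP_cont hconv hP_zero (z := X ω) hω.1
      hω.2.hasFDerivAt).1 i hi, (hω.1 i hi).2⟩
  · intro i j
    have h1 : MemLp (fun z => thresholdPairs P z (i, j)) 2 Γ :=
      (hKp (i, j)).memLp_of_memLp_id (memLp_id_pi_gaussianReal _ _)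
    exact (hX.map_eq ▸ h1).comp_of_map hX.aemeasurable
  · exact (integrable_finsetSum _ fun p _ => hlineX p).congr
      (hdiv.mono fun ω hω => hω.symm)
  · rw [integral_congr_ae hdiv, integral_finsetSum _ fun p _ => hlineX p, Fintype.sum_prod_type,
      degreesOfFreedom, Finset.sum_div]
    refine Finset.sum_congr rfl fun i _ => ?_
    rw [Finset.sum_div]
    refine Finset.sum_congr rfl fun j _ => ?_
    have h1 := covariance_pi_gaussianReal (pairsOfMatrix M) hw (hKp (i, j)) (i, j)
    rw [← hΓ] at h1
    have h2 : cov[fun ω => spectralThreshold P (Z ω) i j, fun ω => Z ω i j; ρ]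
        = cov[fun z => thresholdPairs P z (i, j), fun z : Fin m × Fin n → ℝ => z (i, j); Γ] :=
      hX.covariance_fun_comp ((hKp (i, j)).continuous.measurable.aemeasurable)
        (measurable_pi_apply (i, j)).aemeasurable
    have h3 : ∫ ω, lineDeriv ℝ (fun z => thresholdPairs P z (i, j)) (X ω) (Pi.single (i, j) 1) ∂ρ
        = ∫ z, lineDeriv ℝ (fun z => thresholdPairs P z (i, j)) z (Pi.single (i, j) 1) ∂Γ :=
      hX.integral_comp (hline (i, j)).aestronglyMeasurable
    have hv' : ((v : ℝ) ^ 2) ≠ 0 := by exact_mod_cast hw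
    rw [h2, h1, h3, NNReal.coe_pow, mul_div_cancel_left₀ _ hv']
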